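/- For $p=(a,b,c;d,e)\in\mathbb{C}^3\times\mathbb{C}^2$ (a row vector) put $s=d+e-a-b-c$. The series ${}_3F_2(a,b,c;d,e;1)$ is defined and convergent if $\operatorname{Re}s>0$ and neither $d$ nor $e$ is a non-positive integer. The function ${}_3F_2(a,b,c;d,e;1)/(\Gamma(d)\Gamma(e)\Gamma(s))$ on this domain extends to a unique entire function $E$ on $\mathbb{C}^5$; through $E$, ${}_3F_2(a,b,c;d,e;1)$ is given a (formal) sum $\Gamma(d)\Gamma(e)\Gamma(s)\,E(p)$ by analytic continuation at all parameters. A gamma quotient is $\Gamma\bigl[{\nu_1,\dots,\nu_m\atop\mu_1,\dots,\mu_n}\bigr]=\prod_i\Gamma(\nu_i)/\prod_j\Gamma(\mu_j)$, read as $0$ if some $\mu_j$ is a non-positive integer. A variety (common zero set of a collection of polynomials) $\mathcal{V}\subset\mathbb{C}^3\times\mathbb{C}^2$ has the *gamma quotient summation property* if there are finitely many affine functions $\nu_i,\mu_j$ of $(a,b,c;d,e)$ with rational coefficients such that 1. the points of $\mathcal{V}$ at which no $\nu_i$ is a non-positive integer are dense in $\mathcal{V}$ (in the Euclidean topology); 2.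 at all such points of $\mathcal{V}$ at which the series is defined and convergent, $${}_3F_2(a,b,c;d,e;1)=\Gamma\left[{d,\ e,\ s,\ \nu_1,\dots,\nu_m\atop \mu_1,\dots,\mu_n}\right]$$ (the arguments $d,e,s$ may also occur among the $\mu_j$, so every gamma quotient has this form); 3. the same identity holds in the sense of analytic continuation on all of $\mathcal{V}$, i.e. $E(p)=\Gamma\bigl[{\nu_1,\dots,\nu_m\atop\mu_1,\dots,\mu_n}\bigr]$ at all $p\in\mathcal{V}$ at which no $\nu_i$ is a non-positive integer. Let $A$ be the invertible matrix $$A=\begin{pmatrix}1&0&0&1&1\\0&1&0&1&1\\0&0&1&1&1\\1&1&1&2&1\\1&1&1&1&2\end{pmatrix},$$ and write $(a,b,c;d,e)=(x,y,z;u,v)A$. The Thomae group $\mathfrak{T}\subset GL(5,\mathbb{C})$ consists of the linear transformations of $(a,b,c;d,e)$ that permute the coordinates $x,y,z,u,v$. **Theorem.** $\mathfrak{T}$ has exactly $5!=120$ elements, and if a variety $\mathcal{V}\subset\mathbb{C}^3\times\mathbb{C}^2$ has the gamma quotient summation property, then for every $T\in\mathfrak{T}$ the set $T\mathcal{V}$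 is a variety with the gamma quotient summation property. Moreover, for every variety $\mathcal{V}$ and every $T\in\mathfrak{T}$, $T\mathcal{V}$ has the property if and only if $\mathcal{V}$ has it; that is, the property belongs to entire $\mathfrak{T}$-orbits. -/

import Mathlib

namespace Thomae

noncomputable section

open Complex Filter Topology Metric

/-! ### The series `₃F₂(a, b, c; d, e; 1)`

A parameter vector `(a, b, c; d, e) ∈ ℂ³ × ℂ²` is a point `p : Fin 5 → ℂ`, with
`a = p 0`, `b = p 1`, `c = p 2`, `d = p 3`, `e = p 4`. -/

/-- The parametric excess `s = d + e - a - b - c`. -/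
def excess (p : Fin 5 → ℂ) : ℂ := p 3 + p 4 - p 0 - p 1 - p 2

/-- The rising factorial `(z)_n = z (z + 1) ⋯ (z + n - 1)`. -/
def poch (z : ℂ) (n : ℕ) : ℂ := (ascPochhammer ℂ n).eval z

/-- The sum of the hypergeometric series `₃F₂(a, b, c; d, e; 1)`. -/
def hyp3F2 (p : Fin 5 → ℂ) : ℂ :=
  ∑' n : ℕ, poch (p 0) n * poch (p 1) n * poch (p 2) n /
    (poch (p 3) n * poch (p 4) n * (n.factorial : ℂ))

/-- The conditions under which the series is defined and convergent: the parametric excess has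
positive real part and no lower parameter is a non-positive integer. -/
def Converges (p : Fin 5 → ℂ) : Prop :=
  0 < (excess p).re ∧ (∀ k : ℕ, p 3 ≠ -(k : ℂ)) ∧ (∀ k : ℕ, p 4 ≠ -(k : ℂ))

/-- `E` is the analytic continuation to all of `ℂ³ × ℂ²` of
`₃F₂(a, b, c; d, e; 1) / (Γ(d) Γ(e) Γ(s))`. -/
def IsContinuation (E : (Fin 5 → ℂ) → ℂ) : Prop :=
  Differentiable ℂ E ∧
    ∀ p, Converges p → E p = hyp3F2 p / (Gamma (p 3) * Gamma (p 4) * Gamma (excess p))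

/-! ### Existence of the continuation

The normalised terms are `(a)_n (b)_n (c)_n / (n! Γ(d + n) Γ(e + n))`. Their sum converges locally
uniformly for `Re s > 0`, and a contiguous relation raising `s` continues it to all of `ℂ⁵`. -/

/-- The `n`-th term of the series divided by `Γ(d) Γ(e)`. -/
def normTerm (n : ℕ) (p : Fin 5 → ℂ) : ℂ :=
  poch (p 0) n * poch (p 1) n * poch (p 2) n *
    ((Gamma (p 3 + n))⁻¹ * (Gamma (p 4 + n))⁻¹) / (n.factorial : ℂ)

theorem poch_succ (z : ℂ) (n : ℕ) : poch z (n + 1) = poch z n * (z + n) :=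
  ascPochhammer_succ_eval n z

theorem differentiable_poch (n : ℕ) : Differentiable ℂ fun z => poch z n :=
  (ascPochhammer ℂ n).differentiable

theorem differentiable_term (n : ℕ) : Differentiable ℂ (normTerm n) := by
  have h : ∀ i : Fin 5, Differentiable ℂ fun p : Fin 5 → ℂ => p i := fun i => by fun_prop
  have hp : ∀ i : Fin 5, Differentiable ℂ fun p : Fin 5 → ℂ => poch (p i) n :=
    fun i => (differentiable_poch n).comp (h i)
  have hg : ∀ i : Fin 5, Differentiable ℂ fun p : Fin 5 → ℂ => (Gamma (p i + n))⁻¹ :=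
    fun i => differentiable_one_div_Gamma.comp ((h i).add_const _)
  have := (((hp 0).mul (hp 1)).mul (hp 2)).mul ((hg 3).mul (hg 4))
  exact this.mul_const ((n.factorial : ℂ)⁻¹)

theorem gamma_inv_step (z : ℂ) (n : ℕ) :
    (Gamma (z + n))⁻¹ = (z + n) * (Gamma (z + (n + 1 : ℕ)))⁻¹ := by
  rw [one_div_Gamma_eq_self_mul_one_div_Gamma_add_one]
  push_cast
  rw [add_assoc]

theorem term_succ (n : ℕ) (p : Fin 5 → ℂ) :
    normTerm (n + 1) p * ((n + 1) * ((p 3 + n) * (p 4 + n))) =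
      ((p 0 + n) * (p 1 + n) * (p 2 + n)) * normTerm n p := by
  have hn : (n.factorial : ℂ) ≠ 0 := by exact_mod_cast n.factorial_ne_zero
  have hn1 : (n + 1 : ℂ) ≠ 0 := by exact_mod_cast n.succ_ne_zero
  unfold normTerm
  rw [gamma_inv_step (p 3) n, gamma_inv_step (p 4) n, poch_succ, poch_succ, poch_succ,
    Nat.factorial_succ]
  push_cast
  field_simp

/-- Uniform ratio estimate (Raabe's test). -/
theorem ratio_bound (R δ : ℝ) (hδ : 0 < δ) (hR : 0 ≤ R) :
    ∃ n₀ : ℕ, 1 ≤ n₀ ∧ ∀ n : ℕ, n₀ ≤ n → ∀ p : Fin 5 → ℂ, ‖p‖ ≤ R → 2 * δ ≤ (excess p).re →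
      0 < ‖(p 3 + n) * (p 4 + n)‖ ∧
      ‖(p 0 + n) * (p 1 + n) * (p 2 + n)‖ ≤ (n - δ) * ‖(p 3 + n) * (p 4 + n)‖ := by
  set K : ℝ := 9 * R ^ 2 / 2 + (3 * R ^ 2 + R ^ 3) + R ^ 2 + δ * (2 * R) with hK
  obtain ⟨n₀, hn₀⟩ := exists_nat_ge (K / δ + δ + R + 1)
  have hK0 : 0 ≤ K := by positivity
  have hKd : 0 ≤ K / δ := by positivity
  refine ⟨n₀, ?_, ?_⟩
  · have : (1 : ℝ) ≤ n₀ := by linarith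
    exact_mod_cast this
  intro n hn p hp hs
  have hnn : K / δ + δ + R + 1 ≤ n := hn₀.trans (by exact_mod_cast hn)
  set x : ℝ := (n : ℝ) with hx
  have hx1 : 1 ≤ x := by linarith
  have hpi : ∀ i, ‖p i‖ ≤ R := fun i => (norm_le_pi_norm p i).trans hp
  have hcast : (n : ℂ) = (x : ℂ) := by simp [hx]
  rw [hcast]
  set a := p 0
  set b := p 1
  set c := p 2
  set d := p 3
  set e := p 4
  have ha : ‖a‖ ≤ R := hpi 0
  have hb : ‖b‖ ≤ R := hpi 1
  have hc : ‖c‖ ≤ R := hpi 2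
  have hd : ‖d‖ ≤ R := hpi 3
  have he : ‖e‖ ≤ R := hpi 4
  have hxn : ‖(x : ℂ)‖ = x := by rw [Complex.norm_real, Real.norm_of_nonneg (by linarith)]
  -- lower bound for the denominator
  have hden : x ^ 2 + x * (d.re + e.re) - R ^ 2 ≤ ‖(d + x) * (e + x)‖ := by
    refine le_trans ?_ (Complex.re_le_norm _)
    have h1 : -R ^ 2 ≤ (d * e).re := by
      have h2 : |(d * e).re| ≤ ‖d * e‖ := Complex.abs_re_le_norm _
      have h3 : ‖d * e‖ ≤ R * R := by
        rw [norm_mul]; exact mul_le_mul hd he (norm_nonneg _) hR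
      have := neg_abs_le (d * e).re
      nlinarith
    have h4 : ((d + x) * (e + x)).re = x ^ 2 + x * (d.re + e.re) + (d * e).re := by
      simp only [Complex.mul_re, Complex.add_re, Complex.add_im, Complex.ofReal_re,
        Complex.ofReal_im]
      ring
    linarith
  -- upper bound for the numerator
  have hsig : ‖a + b + c‖ ≤ 3 * R := by
    refine (norm_add₃_le).trans ?_
    linarith
  have hlin : ‖(x : ℂ) + (a + b + c)‖ ≤ x + (a.re + b.re + c.re) + 9 * R ^ 2 / (2 * x) := by
    set w := a + b + c with hw
    have h1 : ‖(x : ℂ) + w‖ ^ 2 = x ^ 2 + 2 * x * w.re + ‖w‖ ^ 2 := by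
      rw [Complex.sq_norm, Complex.sq_norm, Complex.normSq_apply, Complex.normSq_apply]
      simp only [Complex.add_re, Complex.add_im, Complex.ofReal_re, Complex.ofReal_im]
      ring
    have h2 : ‖w‖ ^ 2 ≤ 9 * R ^ 2 := by
      have := norm_nonneg w
      nlinarith
    have h3 : w.re = a.re + b.re + c.re := by simp [hw]
    rw [← h3]
    have h4 : 0 ≤ (‖(x : ℂ) + w‖ - x) ^ 2 := sq_nonneg _
    have h5 : x + w.re + 9 * R ^ 2 / (2 * x) = (2 * x ^ 2 + 2 * x * w.re + 9 * R ^ 2) / (2 * x) := by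
      field_simp
    rw [h5, le_div_iff₀ (by linarith)]
    nlinarith
  have hnum : ‖(a + x) * (b + x) * (c + x)‖ ≤
      x ^ 2 * (x + (a.re + b.re + c.re) + 9 * R ^ 2 / (2 * x)) + (3 * R ^ 2 + R ^ 3) * x := by
    have h1 : (a + x) * (b + x) * (c + x) =
        (x : ℂ) ^ 2 * (x + (a + b + c)) + ((a * b + b * c + c * a) * x + a * b * c) := by ring
    have hab : ‖a * b‖ ≤ R * R := by
      rw [norm_mul]; exact mul_le_mul ha hb (norm_nonneg _) hR
    have hbc : ‖b * c‖ ≤ R * R := by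
      rw [norm_mul]; exact mul_le_mul hb hc (norm_nonneg _) hR
    have hca : ‖c * a‖ ≤ R * R := by
      rw [norm_mul]; exact mul_le_mul hc ha (norm_nonneg _) hR
    have habc : ‖a * b * c‖ ≤ R * R * R := by
      rw [norm_mul]; exact mul_le_mul hab hc (norm_nonneg _) (by positivity)
    have h2 : ‖a * b + b * c + c * a‖ ≤ 3 * R ^ 2 := by
      refine (norm_add₃_le).trans ?_
      nlinarith
    rw [h1]
    refine (norm_add_le _ _).trans (add_le_add ?_ ((norm_add_le _ _).trans ?_))
    · rw [norm_mul, norm_pow, hxn]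
      exact mul_le_mul_of_nonneg_left hlin (by positivity)
    · rw [norm_mul, hxn]
      have h3 : ‖a * b + b * c + c * a‖ * x ≤ 3 * R ^ 2 * x :=
        mul_le_mul_of_nonneg_right h2 (by linarith)
      have h4 : R * R * R ≤ R ^ 3 * x := by
        have h5 : 0 ≤ R ^ 3 * (x - 1) := mul_nonneg (by positivity) (by linarith)
        linarith
      rw [add_mul]
      exact add_le_add h3 (habc.trans h4)
  have hsre : 2 * δ ≤ d.re + e.re - (a.re + b.re + c.re) := by
    have : (excess p).re = d.re + e.re - (a.re + b.re + c.re) := by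
      simp only [excess, Complex.sub_re, Complex.add_re]
      ring
    linarith
  have hdre : |d.re| ≤ R := (Complex.abs_re_le_norm d).trans hd
  have here : |e.re| ≤ R := (Complex.abs_re_le_norm e).trans he
  have hdx : (d + x) ≠ 0 := by
    intro h
    have h1 : (d + x).re = 0 := by rw [h]; simp
    simp only [Complex.add_re, Complex.ofReal_re] at h1
    have := neg_abs_le d.re
    linarith
  have hex : (e + x) ≠ 0 := by
    intro h
    have h1 : (e + x).re = 0 := by rw [h]; simp
    simp only [Complex.add_re, Complex.ofReal_re] at h1
    have := neg_abs_le e.re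
    linarith
  refine ⟨norm_pos_iff.2 (mul_ne_zero hdx hex), hnum.trans ?_⟩
  have hxd : 0 ≤ x - δ := by linarith
  refine le_trans ?_ (mul_le_mul_of_nonneg_left hden hxd)
  have h9 : x ^ 2 * (x + (a.re + b.re + c.re) + 9 * R ^ 2 / (2 * x)) =
      x ^ 3 + x ^ 2 * (a.re + b.re + c.re) + x * (9 * R ^ 2 / 2) := by
    field_simp
  rw [h9]
  have hKx : K ≤ δ * x := by
    have : K / δ ≤ x := by linarith
    rwa [div_le_iff₀ hδ, mul_comm] at this
  have hτ : d.re + e.re ≤ 2 * R := by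
    have h1 := le_abs_self d.re
    have h2 := le_abs_self e.re
    linarith
  have e1 : x * K ≤ x * (δ * x) := mul_le_mul_of_nonneg_left hKx (by linarith)
  have e2 : x ^ 2 * (2 * δ) ≤ x ^ 2 * (d.re + e.re - (a.re + b.re + c.re)) :=
    mul_le_mul_of_nonneg_left hsre (by positivity)
  have e3 : δ * x * (d.re + e.re) ≤ δ * x * (2 * R) :=
    mul_le_mul_of_nonneg_left hτ (by positivity)
  have e4 : 0 ≤ δ * R ^ 2 := by positivity
  rw [hK] at e1
  linarith

/-- Locally uniform bound for the terms: `‖normTerm n p‖ ≤ C n ^ (-1 - δ)`. -/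
theorem term_bound (p₀ : Fin 5 → ℂ) (h : 0 < (excess p₀).re) :
    ∃ r : ℝ, 0 < r ∧ ∃ δ : ℝ, 0 < δ ∧ ∃ n₀ : ℕ, ∃ C : ℝ, 1 ≤ n₀ ∧ ∀ p ∈ closedBall p₀ r,
      ∀ n : ℕ, n₀ ≤ n → ‖normTerm n p‖ ≤ C * (1 / (n : ℝ) ^ (1 + δ)) := by
  set δ : ℝ := (excess p₀).re / 4 with hδ
  have hδ0 : 0 < δ := by positivity
  have hcont : Continuous fun p : Fin 5 → ℂ => (excess p).re := by
    unfold excess; fun_prop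
  obtain ⟨r, hr, hball⟩ : ∃ r > 0, closedBall p₀ r ⊆ {p | 2 * δ < (excess p).re} :=
    nhds_basis_closedBall.mem_iff.1
      ((isOpen_lt continuous_const hcont).mem_nhds (by show 2 * δ < (excess p₀).re; linarith))
  obtain ⟨n₀, h1, hn₀⟩ := ratio_bound (‖p₀‖ + r) δ hδ0 (by positivity)
  obtain ⟨M, hM⟩ := (isCompact_closedBall p₀ r).exists_bound_of_continuousOn
    (differentiable_term n₀).continuous.continuousOn
  refine ⟨r, hr, δ, hδ0, n₀, M * (n₀ : ℝ) ^ (1 + δ), h1, ?_⟩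
  intro p hp n hn
  have hpn : ‖p‖ ≤ ‖p₀‖ + r := by
    have := norm_le_norm_add_norm_sub' p p₀
    rw [mem_closedBall, dist_eq_norm] at hp
    linarith
  have key : ‖normTerm n p‖ * (n : ℝ) ^ (1 + δ) ≤ M * (n₀ : ℝ) ^ (1 + δ) := by
    induction n, hn using Nat.le_induction with
    | base => exact mul_le_mul_of_nonneg_right (hM p hp) (by positivity)
    | succ n hn ih =>
      refine le_trans ?_ ih
      obtain ⟨hpos, hle⟩ := hn₀ n hn p hpn (hball hp).le
      have hts := congrArg norm (term_succ n p)
      have hnp : (0 : ℝ) < n := by exact_mod_cast (h1.trans hn)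
      have hn1 : ‖(n + 1 : ℂ)‖ = (n + 1 : ℝ) := by
        have : (n + 1 : ℂ) = ((n + 1 : ℕ) : ℂ) := by push_cast; ring
        rw [this, Complex.norm_natCast]; push_cast; ring
      rw [norm_mul, norm_mul, hn1, norm_mul _ (normTerm n p)] at hts
      set Q := ‖(p 3 + n) * (p 4 + n)‖
      have hT : 0 ≤ ‖normTerm n p‖ := norm_nonneg _
      have h2 : ‖normTerm (n + 1) p‖ * (n + 1) ≤ (n - δ) * ‖normTerm n p‖ := by
        have h3 : (‖normTerm (n + 1) p‖ * (n + 1)) * Q ≤ ((n - δ) * ‖normTerm n p‖) * Q := by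
          have := mul_le_mul_of_nonneg_right hle hT
          nlinarith
        exact le_of_mul_le_mul_right h3 hpos
      have hb : (n - δ) / (n + 1) ≤ ((n : ℝ) / (n + 1)) ^ (1 + δ) := by
        have hb := one_add_mul_self_le_rpow_one_add (s := -(1 / ((n : ℝ) + 1)))
          (by rw [neg_le_neg_iff, div_le_one (by linarith)]; linarith)
          (p := 1 + δ) (by linarith)
        have e1 : 1 + -(1 / ((n : ℝ) + 1)) = n / (n + 1) := by field_simp; ring
        have e2 : 1 + (1 + δ) * -(1 / ((n : ℝ) + 1)) = (n - δ) / (n + 1) := by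
          field_simp; ring
        rwa [e1, e2] at hb
      rw [Real.div_rpow hnp.le (by linarith), div_le_div_iff₀ (by linarith) (by positivity)] at hb
      push_cast
      have h4 : (‖normTerm (n + 1) p‖ * ((n : ℝ) + 1) ^ (1 + δ)) * (n + 1) ≤
          (‖normTerm n p‖ * (n : ℝ) ^ (1 + δ)) * (n + 1) := by
        have h5 := mul_le_mul_of_nonneg_right h2
          (show 0 ≤ ((n : ℝ) + 1) ^ (1 + δ) by positivity)
        have h6 := mul_le_mul_of_nonneg_left hb hT
        nlinarith
      exact le_of_mul_le_mul_right h4 (by linarith)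
  have hnp : (0 : ℝ) < n := by exact_mod_cast (h1.trans hn)
  rw [mul_one_div, le_div_iff₀ (by positivity)]
  exact key

theorem summable_term (p : Fin 5 → ℂ) (h : 0 < (excess p).re) :
    Summable fun n => normTerm n p := by
  obtain ⟨r, hr, δ, hδ, n₀, C, -, hC⟩ := term_bound p h
  refine Summable.of_norm_bounded_eventually_nat
    ((Real.summable_one_div_nat_rpow.2 (by linarith : 1 < 1 + δ)).mul_left C) ?_
  filter_upwards [eventually_ge_atTop n₀] with n hn
  exact hC p (mem_closedBall_self hr.le) n hn

theorem tendsto_mul_term (p : Fin 5 → ℂ) (h : 0 < (excess p).re) :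
    Tendsto (fun n : ℕ => (n : ℂ) * normTerm n p) atTop (𝓝 0) := by
  obtain ⟨r, hr, δ, hδ, n₀, C, h1, hC⟩ := term_bound p h
  have h0 : Tendsto (fun n : ℕ => C * (n : ℝ) ^ (-δ)) atTop (𝓝 0) := by
    simpa using
      ((tendsto_rpow_neg_atTop hδ).comp tendsto_natCast_atTop_atTop).const_mul C
  refine squeeze_zero_norm' ?_ h0
  filter_upwards [eventually_ge_atTop n₀] with n hn
  have hnp : (0 : ℝ) < n := by exact_mod_cast (h1.trans hn)
  have := hC p (mem_closedBall_self hr.le) n hn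
  rw [norm_mul, Complex.norm_natCast]
  calc (n : ℝ) * ‖normTerm n p‖ ≤ n * (C * (1 / (n : ℝ) ^ (1 + δ))) :=
        mul_le_mul_of_nonneg_left this hnp.le
    _ = C * (n : ℝ) ^ (-δ) := by
        rw [Real.rpow_add hnp, Real.rpow_one, Real.rpow_neg hnp.le]
        field_simp

/-- The sum of the normalised series divided by `Γ(s)`. -/
def baseE (p : Fin 5 → ℂ) : ℂ := (Gamma (excess p))⁻¹ * ∑' n, normTerm n p

theorem differentiableAt_tsum_term (p₀ : Fin 5 → ℂ) (h : 0 < (excess p₀).re) :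
    DifferentiableAt ℂ (fun p => ∑' n, normTerm n p) p₀ := by
  obtain ⟨r, hr, δ, hδ, n₀, C, h1, hC⟩ := term_bound p₀ h
  have hM : ∀ n, ∃ M : ℝ, 0 ≤ M ∧ ∀ p ∈ closedBall p₀ r, ‖normTerm n p‖ ≤ M := by
    intro n
    obtain ⟨M, hM⟩ := (isCompact_closedBall p₀ r).exists_bound_of_continuousOn
      (differentiable_term n).continuous.continuousOn
    exact ⟨M, (norm_nonneg _).trans (hM p₀ (mem_closedBall_self hr.le)), hM⟩
  choose M hM0 hM using hM
  set v : ℕ → ℝ := fun n => if n₀ ≤ n then C * (1 / (n : ℝ) ^ (1 + δ)) else M n with hv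
  have hvb : ∀ n, ∀ p ∈ closedBall p₀ r, ‖normTerm n p‖ ≤ v n := by
    intro n p hp
    simp only [hv]
    split_ifs with hn
    · exact hC p hp n hn
    · exact hM n p hp
  have hvs : Summable v := by
    refine Summable.of_norm_bounded_eventually_nat
      ((Real.summable_one_div_nat_rpow.2 (by linarith : 1 < 1 + δ)).mul_left |C|) ?_
    filter_upwards [eventually_ge_atTop n₀] with n hn
    simp only [hv, if_pos hn]
    rw [norm_mul, Real.norm_eq_abs, Real.norm_of_nonneg (by positivity)]
  have hfd : ∀ n, ∀ p ∈ ball p₀ (r / 2), ‖fderiv ℂ (normTerm n) p‖ ≤ (2 * v n) / (r / 2) := by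
    intro n p hp
    refine norm_fderiv_le_div_of_mapsTo_ball (differentiable_term n).differentiableOn ?_
      (by positivity)
    intro q hq
    rw [mem_closedBall, dist_eq_norm]
    rw [mem_ball] at hp hq
    have hq' : q ∈ closedBall p₀ r := by
      rw [mem_closedBall]
      have := dist_triangle q p p₀
      linarith
    have hp' : p ∈ closedBall p₀ r := by
      rw [mem_closedBall]
      linarith
    have := norm_sub_le (normTerm n q) (normTerm n p)
    have := hvb n q hq'
    have := hvb n p hp'
    linarith
  exact (hasFDerivAt_tsum_of_isPreconnected (hvs.mul_left 2 |>.div_const (r / 2)) isOpen_ball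
    (convex_ball p₀ (r / 2)).isPreconnected
    (fun n p _ => ((differentiable_term n) p).hasFDerivAt) hfd
    (mem_ball_self (by positivity)) (summable_term p₀ h)
    (mem_ball_self (by positivity))).differentiableAt

theorem differentiable_excess : Differentiable ℂ excess := by
  unfold excess; fun_prop

theorem differentiableAt_baseE (p : Fin 5 → ℂ) (h : 0 < (excess p).re) :
    DifferentiableAt ℂ baseE p :=
  ((differentiable_one_div_Gamma.comp differentiable_excess) p).mul
    (differentiableAt_tsum_term p h)

/-- The shift `d ↦ d + 1`. -/
def shiftD (p : Fin 5 → ℂ) : Fin 5 → ℂ := p + Pi.single 3 1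

/-- The shift `(d, e) ↦ (d + 1, e + 1)`. -/
def shiftDE (p : Fin 5 → ℂ) : Fin 5 → ℂ := p + Pi.single 3 1 + Pi.single 4 1

theorem excess_shiftD (p : Fin 5 → ℂ) : excess (shiftD p) = excess p + 1 := by
  simp [excess, shiftD]; ring

theorem excess_shiftDE (p : Fin 5 → ℂ) : excess (shiftDE p) = excess p + 2 := by
  simp [excess, shiftDE]; ring

/-- Coefficient of the contiguous relation. -/
def coeffL (p : Fin 5 → ℂ) : ℂ :=
  excess p * (p 3 + p 4) + (p 0 * p 1 + p 1 * p 2 + p 2 * p 0 - p 3 * p 4)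

/-- Coefficient of the contiguous relation. -/
def coeffM (p : Fin 5 → ℂ) : ℂ :=
  excess p * (p 3 * p 4) + p 0 * p 1 * p 2 - coeffL p * p 4

/-- One step of the continuation by the contiguous relation. -/
def step (f : (Fin 5 → ℂ) → ℂ) (p : Fin 5 → ℂ) : ℂ :=
  coeffL p * f (shiftD p) + (excess p + 1) * coeffM p * f (shiftDE p)

theorem term_rel (n : ℕ) (p : Fin 5 → ℂ) :
    excess p * normTerm n p = coeffL p * normTerm n (shiftD p) + coeffM p * normTerm n (shiftDE p) +
      ((n : ℂ) * normTerm n p - ((n + 1 : ℕ) : ℂ) * normTerm (n + 1) p) := by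
  have hD : normTerm n (shiftD p) = (p 4 + n) * normTerm n (shiftDE p) := by
    have := gamma_inv_step (p 4) n
    simp only [normTerm, shiftD, shiftDE, Pi.add_apply, Pi.single_apply]
    simp
    rw [this]
    push_cast
    rw [show p 4 + (n + 1 : ℂ) = p 4 + 1 + n by ring]
    ring
  have h0 : normTerm n p = (p 3 + n) * (p 4 + n) * normTerm n (shiftDE p) := by
    have h3 := gamma_inv_step (p 3) n
    have h4 := gamma_inv_step (p 4) n
    simp only [normTerm, shiftDE, Pi.add_apply, Pi.single_apply]
    simp
    rw [h3, h4]
    push_cast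
    rw [show p 4 + (n + 1 : ℂ) = p 4 + 1 + n by ring,
      show p 3 + (n + 1 : ℂ) = p 3 + 1 + n by ring]
    ring
  have h1 : ((n + 1 : ℕ) : ℂ) * normTerm (n + 1) p =
      (p 0 + n) * (p 1 + n) * (p 2 + n) * normTerm n (shiftDE p) := by
    have hn : (n.factorial : ℂ) ≠ 0 := by exact_mod_cast n.factorial_ne_zero
    have hn1 : (n + 1 : ℂ) ≠ 0 := by exact_mod_cast n.succ_ne_zero
    simp only [normTerm, shiftDE, Pi.add_apply, Pi.single_apply, poch_succ, Nat.factorial_succ]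
    simp
    rw [show p 4 + (n + 1 : ℂ) = p 4 + 1 + n by ring,
      show p 3 + (n + 1 : ℂ) = p 3 + 1 + n by ring]
    field_simp
  rw [h1, hD, h0]
  simp only [coeffM, coeffL, excess]
  ring

theorem baseE_step (p : Fin 5 → ℂ) (h : 0 < (excess p).re) : step baseE p = baseE p := by
  have hD : 0 < (excess (shiftD p)).re := by rw [excess_shiftD]; simp; linarith
  have hDE : 0 < (excess (shiftDE p)).re := by rw [excess_shiftDE]; simp; linarith
  have htel : HasSum (fun n : ℕ => (n : ℂ) * normTerm n p - ((n + 1 : ℕ) : ℂ) * normTerm (n + 1) p)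
      0 := by
    have hs : Summable fun n : ℕ =>
        (n : ℂ) * normTerm n p - ((n + 1 : ℕ) : ℂ) * normTerm (n + 1) p := by
      have := (((summable_term p h).mul_left (excess p)).sub
        ((summable_term _ hD).mul_left (coeffL p))).sub
        ((summable_term _ hDE).mul_left (coeffM p))
      refine this.congr fun n => ?_
      rw [term_rel n p]; ring
    rw [hs.hasSum_iff_tendsto_nat]
    have e : (fun n : ℕ => ∑ i ∈ Finset.range n,
        ((i : ℂ) * normTerm i p - ((i + 1 : ℕ) : ℂ) * normTerm (i + 1) p)) =
        fun n : ℕ => -((n : ℂ) * normTerm n p) := by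
      funext n
      rw [Finset.sum_range_sub' (fun i : ℕ => (i : ℂ) * normTerm i p)]
      simp
    rw [e]
    simpa using (tendsto_mul_term p h).neg
  have hsum : excess p * ∑' n, normTerm n p =
      coeffL p * ∑' n, normTerm n (shiftD p) + coeffM p * ∑' n, normTerm n (shiftDE p) := by
    have h1 := (summable_term p h).hasSum.mul_left (excess p)
    have h2 := (((summable_term _ hD).hasSum.mul_left (coeffL p)).add
      ((summable_term _ hDE).hasSum.mul_left (coeffM p))).add htel
    rw [add_zero] at h2
    refine h1.unique ?_
    convert h2 using 1
    funext n
    exact term_rel n p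
  have g1 := one_div_Gamma_eq_self_mul_one_div_Gamma_add_one (excess p)
  have g2 := one_div_Gamma_eq_self_mul_one_div_Gamma_add_one (excess p + 1)
  rw [add_assoc, one_add_one_eq_two] at g2
  unfold step baseE
  rw [excess_shiftD, excess_shiftDE, g1]
  linear_combination (Gamma (excess p + 1))⁻¹ * (-hsum) -
    coeffM p * (∑' n, normTerm n (shiftDE p)) * g2

/-- The `k`-fold continued function, correct for `Re s > -k`. -/
def iterE (k : ℕ) : (Fin 5 → ℂ) → ℂ := step^[k] baseE

theorem iterE_succ (k : ℕ) : iterE (k + 1) = step (iterE k) :=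
  Function.iterate_succ_apply' _ _ _

theorem iterE_eq (k : ℕ) : ∀ p, -(k : ℝ) < (excess p).re → iterE (k + 1) p = iterE k p := by
  induction k with
  | zero => intro p hp; exact baseE_step p (by simpa using hp)
  | succ k ih =>
    intro p hp
    push_cast at hp
    have h1 := ih (shiftD p) (by rw [excess_shiftD]; simp; linarith)
    have h2 := ih (shiftDE p) (by rw [excess_shiftDE]; simp; linarith)
    rw [iterE_succ (k + 1), iterE_succ k]
    rw [iterE_succ k] at h1 h2
    simp only [step] at h1 h2 ⊢
    rw [h1, h2]

theorem iterE_eq_of_le (k m : ℕ) (hkm : k ≤ m) (p : Fin 5 → ℂ) (hp : -(k : ℝ) < (excess p).re) :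
    iterE m p = iterE k p := by
  induction m, hkm using Nat.le_induction with
  | base => rfl
  | succ m hm ih =>
    rw [iterE_eq m p ?_, ih]
    have : (k : ℝ) ≤ m := by exact_mod_cast hm
    linarith

theorem differentiableAt_iterE (k : ℕ) :
    ∀ p, -(k : ℝ) < (excess p).re → DifferentiableAt ℂ (iterE k) p := by
  induction k with
  | zero => intro p hp; exact differentiableAt_baseE p (by simpa using hp)
  | succ k ih =>
    intro p hp
    push_cast at hp
    have h1 := ih (shiftD p) (by rw [excess_shiftD]; simp; linarith)
    have h2 := ih (shiftDE p) (by rw [excess_shiftDE]; simp; linarith)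
    have s1 : DifferentiableAt ℂ shiftD p := by unfold shiftD; fun_prop
    have s2 : DifferentiableAt ℂ shiftDE p := by unfold shiftDE; fun_prop
    have c1 : DifferentiableAt ℂ coeffL p := by unfold coeffL excess; fun_prop
    have c2 : DifferentiableAt ℂ coeffM p := by unfold coeffM coeffL excess; fun_prop
    rw [iterE_succ]
    exact (c1.mul (h1.comp p s1)).add
      ((((differentiable_excess p).add_const 1).mul c2).mul (h2.comp p s2))

theorem gamma_inv_poch (z : ℂ) (hz : ∀ k : ℕ, z ≠ -(k : ℂ)) (n : ℕ) :
    (Gamma (z + n))⁻¹ = (Gamma z)⁻¹ / poch z n := by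
  induction n with
  | zero => simp [poch]
  | succ n ih =>
    have hzn : z + n ≠ 0 := fun h => hz n (eq_neg_of_add_eq_zero_left h)
    rw [gamma_inv_step, ] at ih
    rw [poch_succ, ← div_div, ← ih]
    field_simp

theorem baseE_of_converges (p : Fin 5 → ℂ) (hp : Converges p) :
    baseE p = hyp3F2 p / (Gamma (p 3) * Gamma (p 4) * Gamma (excess p)) := by
  have h : ∀ n, normTerm n p = (Gamma (p 3) * Gamma (p 4))⁻¹ *
      (poch (p 0) n * poch (p 1) n * poch (p 2) n /
        (poch (p 3) n * poch (p 4) n * (n.factorial : ℂ))) := by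
    intro n
    unfold normTerm
    rw [gamma_inv_poch _ hp.2.1, gamma_inv_poch _ hp.2.2, mul_inv]
    simp only [div_eq_mul_inv, mul_inv]
    ring
  unfold baseE hyp3F2
  rw [tsum_congr h, tsum_mul_left]
  simp only [div_eq_mul_inv, mul_inv]
  ring

theorem exists_continuation : ∃ E, IsContinuation E := by
  have hK : ∀ p : Fin 5 → ℂ, ∃ k : ℕ, -(k : ℝ) < (excess p).re := fun p => by
    obtain ⟨k, hk⟩ := exists_nat_gt (-(excess p).re)
    exact ⟨k, by linarith⟩
  choose K hK using hK
  have key : ∀ (k : ℕ) (p : Fin 5 → ℂ), -(k : ℝ) < (excess p).re →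
      iterE (K p) p = iterE k p := by
    intro k p hp
    rcases le_total k (K p) with h | h
    · exact iterE_eq_of_le k (K p) h p hp
    · exact (iterE_eq_of_le (K p) k h p (hK p)).symm
  refine ⟨fun p => iterE (K p) p, ?_, ?_⟩
  · intro p
    refine (differentiableAt_iterE (K p) p (hK p)).congr_of_eventuallyEq ?_
    have hcont : Continuous fun p : Fin 5 → ℂ => (excess p).re := by
      unfold excess; fun_prop
    filter_upwards [(isOpen_lt continuous_const hcont).mem_nhds (hK p)] with q hq
    exact key (K p) q hq
  · intro p hp
    rw [← baseE_of_converges p hp]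
    exact key 0 p (by simpa using hp.1)

/-- The entire function continuing `₃F₂(a, b, c; d, e; 1) / (Γ(d) Γ(e) Γ(s))`; it is the only one,
by the identity theorem. In the coordinates `x, y, z, u, v` below it is `₃E₂(x, y, z; u, v)`. -/
def continuedE : (Fin 5 → ℂ) → ℂ := Classical.choose exists_continuation

theorem continuedE_spec : IsContinuation continuedE := Classical.choose_spec exists_continuation

/-! ### Gamma quotients -/

/-- An affine function of `(a, b, c; d, e)` with rational coefficients: the linear coefficients
and the constant term. -/
abbrev RatAffine := (Fin 5 → ℚ) × ℚ

/-- The value of the affine function `l` at `p`. -/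
def RatAffine.value (l : RatAffine) (p : Fin 5 → ℂ) : ℂ := ∑ i, (l.1 i : ℂ) * p i + (l.2 : ℂ)

/-- The affine function `d`. -/
def formD : RatAffine := (![0, 0, 0, 1, 0], 0)

/-- The affine function `e`. -/
def formE : RatAffine := (![0, 0, 0, 0, 1], 0)

/-- The affine function `s = d + e - a - b - c`. -/
def formS : RatAffine := (![-1, -1, -1, 1, 1], 0)

/-- The gamma quotient `∏ Γ(ν(p)) / ∏ Γ(μ(p))`, with `ν` in the list `N` and `μ` in the list `D`.
As `Complex.Gamma` and inversion take the value `0` at a pole and at `0`, it is zero if a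
denominator argument is a non-positive integer. -/
def gammaQuotient (N D : List RatAffine) (p : Fin 5 → ℂ) : ℂ :=
  (N.map fun l => Gamma (l.value p)).prod / (D.map fun l => Gamma (l.value p)).prod

/-- No argument of the list is a non-positive integer at `p`. -/
def NoPole (N : List RatAffine) (p : Fin 5 → ℂ) : Prop :=
  ∀ l ∈ N, ∀ k : ℕ, l.value p ≠ -(k : ℂ)

/-- `V` is an algebraic variety: the common zero set of a collection of polynomials. -/
def IsVariety (V : Set (Fin 5 → ℂ)) : Prop :=
  ∃ S : Set (MvPolynomial (Fin 5) ℂ), V = {p | ∀ f ∈ S, MvPolynomial.eval p f = 0}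

/-- The gamma quotient summation property of `V`: for a fixed choice of affine functions with
rational coefficients, `₃F₂(a, b, c; d, e; 1) = Γ[d, e, s, N; D]` at the points of `V`. (Every
gamma quotient has this form, since `d, e, s` may be repeated in `D`.)

* `generic`: the arguments in `N` avoid the poles of `Γ` at generic points of `V`.
* `sum`: the identity holds wherever the series converges on `V`.
* `formal`: in the sense of analytic continuation in `ℂ³ × ℂ²` it holds on all of `V`. Both
  sides are divided by `Γ(d) Γ(e) Γ(s)`, since the continuation of `₃F₂` can be infinite where
  one of these factors is, while that of `₃F₂ / (Γ(d) Γ(e) Γ(s))` is entire. -/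
def GammaQuotientSummation (V : Set (Fin 5 → ℂ)) : Prop :=
  ∃ N D : List RatAffine,
    -- generic
    V ⊆ closure {p ∈ V | NoPole N p} ∧
    -- sum
    (∀ p ∈ V, Converges p → NoPole N p →
      hyp3F2 p = gammaQuotient (formD :: formE :: formS :: N) D p) ∧
    -- formal
    (∀ p ∈ V, NoPole N p → continuedE p = gammaQuotient N D p)

/-! ### The Thomae group -/

/-- The matrix of the change of parameters `(a, b, c; d, e) = (x, y, z; u, v) A`. -/
def matA : Matrix (Fin 5) (Fin 5) ℂ :=
  !![1, 0, 0, 1, 1;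
     0, 1, 0, 1, 1;
     0, 0, 1, 1, 1;
     1, 1, 1, 2, 1;
     1, 1, 1, 1, 2]

/-- The Thomae group: the `T ∈ GL(5, ℂ)` that act on parameter (row) vectors `(a, b, c; d, e)` by
a permutation of the coordinates `x, y, z, u, v`. -/
def thomaeGroup : Subgroup (GL (Fin 5) ℂ) where
  carrier := {T | ∃ σ : Equiv.Perm (Fin 5), ∀ q : Fin 5 → ℂ,
    Matrix.vecMul (Matrix.vecMul q matA) (T : Matrix (Fin 5) (Fin 5) ℂ) =
      Matrix.vecMul (q ∘ σ) matA}
  one_mem' := ⟨1, fun q => by simp⟩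
  mul_mem' := by
    rintro S T ⟨σ, hσ⟩ ⟨τ, hτ⟩
    refine ⟨σ * τ, fun q => ?_⟩
    rw [Units.val_mul, ← Matrix.vecMul_vecMul, hσ, hτ]
    rfl
  inv_mem' := by
    rintro T ⟨σ, hσ⟩
    refine ⟨σ⁻¹, fun q => ?_⟩
    have h := hσ (q ∘ ⇑σ⁻¹)
    have e : (q ∘ ⇑σ⁻¹) ∘ ⇑σ = q := by
      funext i
      simp
    rw [e] at h
    rw [← h, Matrix.vecMul_vecMul, ← Units.val_mul, mul_inv_cancel, Units.val_one,
      Matrix.vecMul_one]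

/-- The linearly transformed set `T V`. -/
def transform (T : GL (Fin 5) ℂ) (V : Set (Fin 5 → ℂ)) : Set (Fin 5 → ℂ) :=
  (fun p => Matrix.vecMul p (T : Matrix (Fin 5) (Fin 5) ℂ)) '' V

end

end Thomae

namespace Thomae

noncomputable section

open Filter Topology

/-! ### Asymptotics of the gamma function -/

/-! The theorem rests on one fact: in the coordinates `x, y, z, u, v` the entire function
`continuedE` is symmetric. A gamma quotient formula on `V` then becomes one on `T V` by composing
its arguments with `T⁻¹`. This matrix is rational because `A` and its inverse are, so the new affine
functions still have rational coefficients. Generic avoidance of poles passes through the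
homeomorphism `T`, and the identity for the convergent series follows from the one for the
continuation.

For the symmetry, a transposition and a 5-cycle generate `S₅`
(`Equiv.Perm.closure_prime_cycle_swap`). Exchanging `x` and `y` just exchanges `a` and `b`. The
5-cycle is Thomae's transformation, with upper parameters `d - a, e - a, s` and lower parameters `s
+ b, s + c`. For positive `a, b, c, d - a, e - a, s` it is proved by writing `Γ(a+n) / (Γ(d+n)
Γ(e+n))` as a Gauss sum, interchanging the two summations of the resulting positive double series,
and summing again by Gauss (`tsum_hypTerm_thomae`). All these quantities are positive when `x, y, z,
u, v` are, and the identity theorem extends the equality to `ℂ⁵`.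

Gauss's theorem itself comes from the contiguous relation `c ↦ c + 1`, iterated to the limit `c →
∞`. -/

theorem real_gamma_add_nat {s : ℝ} (hs : 0 < s) (n : ℕ) :
    Real.Gamma (s + n) = (∏ j ∈ Finset.range n, (s + j)) * Real.Gamma s := by
  induction n with
  | zero => simp
  | succ n ih =>
    rw [Finset.prod_range_succ, Nat.cast_succ, ← add_assoc, Real.Gamma_add_one (by positivity), ih]
    ring

/-- Euler's limit formula for `Γ(s)`, divided by `Γ(s)`. -/
theorem tendsto_rpow_mul_factorial_div_gamma {s : ℝ} (hs : 0 < s) :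
    Tendsto (fun n : ℕ => (n : ℝ) ^ s * n.factorial / Real.Gamma (s + (n + 1 : ℕ))) atTop (𝓝 1) := by
  have hG := (Real.Gamma_pos_of_pos hs).ne'
  have h := (Real.GammaSeq_tendsto_Gamma s).div_const (Real.Gamma s)
  rw [div_self hG] at h
  refine h.congr fun n => ?_
  rw [real_gamma_add_nat hs, Real.GammaSeq, div_div]

/-- By Euler's limit each `Γ(s + n + 1)` behaves like `n ^ s * n!`; the balance condition makes the
powers of `n` cancel. -/
theorem tendsto_gamma_ratio {s t u v : ℝ} (hs : 0 < s) (ht : 0 < t) (hu : 0 < u) (hv : 0 < v)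
    (h : s + t = u + v) :
    Tendsto (fun n : ℕ => Real.Gamma (s + n) * Real.Gamma (t + n) /
      (Real.Gamma (u + n) * Real.Gamma (v + n))) atTop (𝓝 1) := by
  rw [← tendsto_add_atTop_iff_nat 1]
  have h1 := ((tendsto_rpow_mul_factorial_div_gamma hu).mul
    (tendsto_rpow_mul_factorial_div_gamma hv)).div
    ((tendsto_rpow_mul_factorial_div_gamma hs).mul
    (tendsto_rpow_mul_factorial_div_gamma ht)) (by norm_num)
  rw [show (1 : ℝ) * 1 / (1 * 1) = 1 by norm_num] at h1
  refine h1.congr' ?_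
  filter_upwards [eventually_gt_atTop 0] with n hn
  have hn' : (0 : ℝ) < n := by exact_mod_cast hn
  have hf : (n.factorial : ℝ) ≠ 0 := by exact_mod_cast n.factorial_ne_zero
  have g : ∀ {x : ℝ}, 0 < x → Real.Gamma (x + (n + 1 : ℕ)) ≠ 0 := fun hx =>
    (Real.Gamma_pos_of_pos (by positivity)).ne'
  have e : (n : ℝ) ^ s * (n : ℝ) ^ t = (n : ℝ) ^ u * (n : ℝ) ^ v := by
    rw [← Real.rpow_add hn', ← Real.rpow_add hn', h]
  have p : ∀ x : ℝ, (n : ℝ) ^ x ≠ 0 := fun x => (Real.rpow_pos_of_pos hn' x).ne'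
  have g1 := g hs
  have g2 := g ht
  have g3 := g hu
  have g4 := g hv
  have p1 := p s
  have p2 := p t
  simp only [Pi.div_apply]
  rw [div_mul_div_comm, div_mul_div_comm, div_div_div_eq, div_eq_div_iff (by positivity)
    (by positivity)]
  linear_combination (-(n.factorial : ℝ) ^ 2 * Real.Gamma (s + (n + 1 : ℕ)) *
    Real.Gamma (t + (n + 1 : ℕ)) * Real.Gamma (u + (n + 1 : ℕ)) * Real.Gamma (v + (n + 1 : ℕ))) * e

/-! ### Gauss's summation theorem -/

/-- The `n`-th term of `Γ(a) Γ(b) / Γ(c) · ₂F₁(a, b; c; 1)`. -/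
def gaussTerm (a b c : ℝ) (n : ℕ) : ℝ :=
  Real.Gamma (a + n) * Real.Gamma (b + n) / (n.factorial * Real.Gamma (c + n))

theorem poch_ofReal {x : ℝ} (hx : 0 < x) (n : ℕ) :
    poch (x : ℂ) n = ((Real.Gamma (x + n) / Real.Gamma x : ℝ) : ℂ) := by
  rw [real_gamma_add_nat hx, mul_div_cancel_right₀ _ (Real.Gamma_pos_of_pos hx).ne']
  induction n with
  | zero => simp [poch]
  | succ n ih =>
    rw [poch_succ, ih, Finset.prod_range_succ]
    push_cast
    ring

/-- The `n`-th term of `Γ(a) Γ(b) Γ(c) / (Γ(d) Γ(e)) · ₃F₂(a, b, c; d, e; 1)`. -/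
def hypTerm (r : Fin 5 → ℝ) (n : ℕ) : ℝ :=
  Real.Gamma (r 0 + n) * Real.Gamma (r 1 + n) * Real.Gamma (r 2 + n) /
    (n.factorial * Real.Gamma (r 3 + n) * Real.Gamma (r 4 + n))

theorem normTerm_ofReal {r : Fin 5 → ℝ} (h0 : 0 < r 0) (h1 : 0 < r 1) (h2 : 0 < r 2) (n : ℕ) :
    normTerm n (fun i => (r i : ℂ)) =
      ((hypTerm r n / (Real.Gamma (r 0) * Real.Gamma (r 1) * Real.Gamma (r 2)) : ℝ) : ℂ) := by
  have hg : ∀ x : ℝ, Complex.Gamma ((x : ℂ) + n) = (Real.Gamma (x + n) : ℝ) := fun x => by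
    rw [← Complex.Gamma_ofReal]; push_cast; rfl
  unfold normTerm hypTerm
  rw [poch_ofReal h0, poch_ofReal h1, poch_ofReal h2, hg, hg]
  push_cast
  simp only [div_eq_mul_inv, mul_inv]
  ring

theorem excess_ofReal (r : Fin 5 → ℝ) :
    (excess fun i => (r i : ℂ)).re = r 3 + r 4 - r 0 - r 1 - r 2 := by
  simp [excess]

theorem hypTerm_eq {r : Fin 5 → ℝ} (h0 : 0 < r 0) (h1 : 0 < r 1) (h2 : 0 < r 2) (n : ℕ) :
    ((hypTerm r n : ℝ) : ℂ) =
      ((Real.Gamma (r 0) * Real.Gamma (r 1) * Real.Gamma (r 2) : ℝ) : ℂ) *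
        normTerm n (fun i => (r i : ℂ)) := by
  have g0 := Real.Gamma_pos_of_pos h0
  have g1 := Real.Gamma_pos_of_pos h1
  have g2 := Real.Gamma_pos_of_pos h2
  rw [normTerm_ofReal h0 h1 h2, ← Complex.ofReal_mul, mul_div_cancel₀ _ (by positivity)]

theorem summable_hypTerm {r : Fin 5 → ℝ} (h0 : 0 < r 0) (h1 : 0 < r 1) (h2 : 0 < r 2)
    (h : 0 < r 3 + r 4 - r 0 - r 1 - r 2) : Summable (hypTerm r) := by
  rw [← Complex.summable_ofReal]
  simp only [hypTerm_eq h0 h1 h2]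
  exact (summable_term _ (by rwa [excess_ofReal])).mul_left _

theorem tendsto_mul_hypTerm {r : Fin 5 → ℝ} (h0 : 0 < r 0) (h1 : 0 < r 1) (h2 : 0 < r 2)
    (h : 0 < r 3 + r 4 - r 0 - r 1 - r 2) :
    Tendsto (fun n : ℕ => (n : ℝ) * hypTerm r n) atTop (𝓝 0) := by
  have := ((tendsto_mul_term _ (by rwa [excess_ofReal])).const_mul
    (((Real.Gamma (r 0) * Real.Gamma (r 1) * Real.Gamma (r 2) : ℝ)) : ℂ))
  rw [mul_zero] at this
  refine ((Complex.continuous_re.tendsto 0).comp this).congr fun n => ?_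
  have e := hypTerm_eq h0 h1 h2 n
  rw [Function.comp_apply, mul_left_comm, ← e, ← Complex.ofReal_natCast, ← Complex.ofReal_mul,
    Complex.ofReal_re]

/-- A parameter `1` above and below cancels, so the convergence and decay estimates for `₃F₂` apply
to `₂F₁`. -/
theorem hypTerm_gauss (a b c : ℝ) : hypTerm ![a, b, 1, c, 1] = gaussTerm a b c := by
  funext n
  have : Real.Gamma (1 + n) ≠ 0 := (Real.Gamma_pos_of_pos (by positivity)).ne'
  simp only [hypTerm, gaussTerm, Matrix.cons_val]
  rw [mul_div_mul_right _ _ this]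

theorem summable_gaussTerm {a b c : ℝ} (ha : 0 < a) (hb : 0 < b) (h : a + b < c) :
    Summable (gaussTerm a b c) := by
  rw [← hypTerm_gauss]
  exact summable_hypTerm (by simpa) (by simpa) (by simp) (by simp; linarith)

theorem tendsto_mul_gaussTerm {a b c : ℝ} (ha : 0 < a) (hb : 0 < b) (h : a + b < c) :
    Tendsto (fun n : ℕ => (n : ℝ) * gaussTerm a b c n) atTop (𝓝 0) := by
  rw [← hypTerm_gauss]
  exact tendsto_mul_hypTerm (by simpa) (by simpa) (by simp) (by simp; linarith)

theorem gaussTerm_nonneg {a b c : ℝ} (ha : 0 < a) (hb : 0 < b) (hc : 0 < c) (n : ℕ) :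
    0 ≤ gaussTerm a b c n := by
  have := Real.Gamma_pos_of_pos (show 0 < a + n by positivity)
  have := Real.Gamma_pos_of_pos (show 0 < b + n by positivity)
  have := Real.Gamma_pos_of_pos (show 0 < c + n by positivity)
  unfold gaussTerm
  positivity

/-- A telescoping certificate for the contiguous relation in `c`. After removal of common factors it
reads `(c-a-b)(c+n) - (c-a)(c-b) = n(c+n) - (a+n)(b+n)`. -/
theorem gaussTerm_rel {a b c : ℝ} (ha : 0 < a) (hb : 0 < b) (hc : 0 < c) (n : ℕ) :
    (c - a - b) * gaussTerm a b c n - (c - a) * (c - b) * gaussTerm a b (c + 1) n =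
      (n : ℝ) * gaussTerm a b c n - ((n + 1 : ℕ) : ℝ) * gaussTerm a b c (n + 1) := by
  have hG := (Real.Gamma_pos_of_pos (show 0 < c + n by positivity)).ne'
  have hc0 : c + n ≠ 0 := by positivity
  have e : ∀ {x : ℝ}, 0 < x → Real.Gamma (x + (n + 1 : ℕ)) = (x + n) * Real.Gamma (x + n) :=
    fun hx => by rw [Nat.cast_succ, ← add_assoc, Real.Gamma_add_one (by positivity)]
  have e1 : Real.Gamma (c + 1 + n) = (c + n) * Real.Gamma (c + n) := by
    rw [← e hc]; push_cast; ring_nf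
  unfold gaussTerm
  rw [e ha, e hb, e hc, e1, Nat.factorial_succ]
  push_cast
  field_simp
  ring

theorem tsum_gaussTerm_rel {a b c : ℝ} (ha : 0 < a) (hb : 0 < b) (h : a + b < c) :
    (c - a - b) * ∑' n, gaussTerm a b c n =
      (c - a) * (c - b) * ∑' n, gaussTerm a b (c + 1) n := by
  have hs := ((summable_gaussTerm ha hb h).hasSum.mul_left (c - a - b)).sub
    ((summable_gaussTerm ha hb (show a + b < c + 1 by linarith)).hasSum.mul_left
      ((c - a) * (c - b)))
  simp only [gaussTerm_rel ha hb (show 0 < c by linarith)] at hs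
  have ht := hs.tendsto_sum_nat
  simp only [Finset.sum_range_sub' (fun i : ℕ => (i : ℝ) * gaussTerm a b c i)] at ht
  -- The partial sums telescope to `0 * t 0 - N * t N`, where `t` is the Gauss term, and `N * t N →
  -- 0`.
  have h0 := (tendsto_mul_gaussTerm ha hb h).const_sub (((0 : ℕ) : ℝ) * gaussTerm a b c 0)
  have := tendsto_nhds_unique ht h0
  simp at this
  linarith

/-- As the lower parameter grows, `Γ(c+N) / Γ(c+N+n)` tends to `0` unless `n = 0`, so only the first
term survives; dominated convergence justifies the termwise limit. -/
theorem tendsto_gamma_mul_tsum_gaussTerm {a b c : ℝ} (ha : 0 < a) (hb : 0 < b) (h : a + b < c) :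
    Tendsto (fun N : ℕ => Real.Gamma (c + N) * ∑' n, gaussTerm a b (c + N) n) atTop
      (𝓝 (Real.Gamma a * Real.Gamma b)) := by
  have hc : 0 < c := by linarith
  have hpos : ∀ N : ℕ, 0 < Real.Gamma (c + N) := fun N => Real.Gamma_pos_of_pos (by positivity)
  have hpos2 : ∀ N n : ℕ, 0 < Real.Gamma (c + N + n) := fun N n =>
    Real.Gamma_pos_of_pos (by positivity)
  -- The ratio decreases in `N`, so the series at `N = 0` is a dominating one.
  have hanti : ∀ n N : ℕ, Real.Gamma (c + N) / Real.Gamma (c + N + n) ≤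
      Real.Gamma c / Real.Gamma (c + n) := by
    intro n N
    induction N with
    | zero => simp
    | succ N ih =>
      refine le_trans ?_ ih
      have e1 : Real.Gamma (c + (N + 1 : ℕ)) = (c + N) * Real.Gamma (c + N) := by
        rw [Nat.cast_succ, ← add_assoc, Real.Gamma_add_one (by positivity)]
      have e2 : Real.Gamma (c + (N + 1 : ℕ) + n) = (c + N + n) * Real.Gamma (c + N + n) := by
        rw [← Real.Gamma_add_one (by positivity)]; push_cast; ring_nf
      have h1 := hpos N
      have h2 := hpos2 N n
      rw [e1, e2, div_le_div_iff₀ (by positivity) h2]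
      have : 0 ≤ Real.Gamma (c + N) * Real.Gamma (c + N + n) * n := by positivity
      linarith
  have hsum : ∑' n : ℕ, (if n = 0 then Real.Gamma a * Real.Gamma b else 0) =
      Real.Gamma a * Real.Gamma b := tsum_ite_eq 0 _
  rw [← hsum]
  simp only [← tsum_mul_left]
  have hfac : ∀ x : ℝ, ∀ n : ℕ, Real.Gamma x * gaussTerm a b x n =
      Real.Gamma (a + n) * Real.Gamma (b + n) / n.factorial *
        (Real.Gamma x / Real.Gamma (x + n)) := by
    intro x n
    unfold gaussTerm
    rw [div_mul_div_comm, mul_comm (Real.Gamma x), div_mul_eq_mul_div]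
  have hco : ∀ n : ℕ, 0 ≤ Real.Gamma (a + n) * Real.Gamma (b + n) / n.factorial := fun n => by
    have := Real.Gamma_pos_of_pos (show 0 < a + n by positivity)
    have := Real.Gamma_pos_of_pos (show 0 < b + n by positivity)
    positivity
  refine tendsto_tsum_of_dominated_convergence
    ((summable_gaussTerm ha hb h).mul_left (Real.Gamma c)) ?_ ?_
  · intro n
    rcases n with _ | n
    · simp only [hfac, if_true, Nat.cast_zero, add_zero, Nat.factorial_zero, Nat.cast_one, div_one]
      refine tendsto_const_nhds.congr fun N => ?_
      rw [div_self (hpos N).ne', mul_one]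
    · simp only [hfac, Nat.succ_ne_zero, if_false]
      rw [← mul_zero (Real.Gamma (a + (n + 1 : ℕ)) * Real.Gamma (b + (n + 1 : ℕ)) /
        (n + 1).factorial)]
      refine Tendsto.const_mul _ ?_
      have h0 : Tendsto (fun N : ℕ => 1 / (N : ℝ)) atTop (𝓝 0) := tendsto_one_div_atTop_nhds_zero_nat
      refine squeeze_zero' (Eventually.of_forall fun N => ?_) ?_ h0
      · exact (div_pos (hpos N) (hpos2 N _)).le
      · filter_upwards [eventually_ge_atTop 1] with N hN
        have hN' : (1 : ℝ) ≤ N := by exact_mod_cast hN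
        -- The first increment of the argument already gains a factor `c + N ≥ N`; later ones gain
        -- factors at least `1`.
        have key : (N : ℝ) * Real.Gamma (c + N) ≤ Real.Gamma (c + N + (n + 1 : ℕ)) := by
          clear h0
          induction n with
          | zero =>
            rw [zero_add, Nat.cast_one, Real.Gamma_add_one (by positivity)]
            have := hpos N
            nlinarith
          | succ n ih =>
            refine ih.trans ?_
            rw [Nat.cast_succ (n + 1), ← add_assoc, Real.Gamma_add_one (by positivity)]
            have h2 := hpos2 N (n + 1)
            refine le_mul_of_one_le_left h2.le ?_
            have : (0 : ℝ) ≤ (n + 1 : ℕ) := by positivity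
            linarith
        rw [div_le_div_iff₀ (hpos2 N _) (by linarith)]
        linarith
  · refine Eventually.of_forall fun N n => ?_
    rw [hfac, hfac, Real.norm_of_nonneg
      (mul_nonneg (hco n) (div_pos (hpos N) (hpos2 N n)).le)]
    exact mul_le_mul_of_nonneg_left (hanti n N) (hco n)

/-- Gauss's summation theorem. -/
theorem tsum_gaussTerm {a b c : ℝ} (ha : 0 < a) (hb : 0 < b) (h : a + b < c) :
    ∑' n, gaussTerm a b c n = Real.Gamma a * Real.Gamma b * Real.Gamma (c - a - b) /
      (Real.Gamma (c - a) * Real.Gamma (c - b)) := by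
  -- `G N` is the quotient of the sum by its claimed value, up to `Γ(a) Γ(b)`, with `c` replaced by
  -- `c + N`. The contiguous relation makes it constant, so it equals its limit `Γ(a) Γ(b)`.
  set G : ℕ → ℝ := fun N => Real.Gamma (c - a + N) * Real.Gamma (c - b + N) *
    (∑' n, gaussTerm a b (c + N) n) / Real.Gamma (c - a - b + N) with hG
  have hp : ∀ {x : ℝ}, 0 < x → ∀ N : ℕ, 0 < Real.Gamma (x + N) := fun hx N =>
    Real.Gamma_pos_of_pos (by positivity)
  have h1 : 0 < c - a := by linarith
  have h2 : 0 < c - b := by linarith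
  have h3 : 0 < c - a - b := by linarith
  have h4 : 0 < c := by linarith
  have hconst : ∀ N, G N = G 0 := by
    intro N
    induction N with
    | zero => rfl
    | succ N ih =>
      rw [← ih]
      have e : ∀ {x : ℝ}, 0 < x → Real.Gamma (x + (N + 1 : ℕ)) = (x + N) * Real.Gamma (x + N) :=
        fun hx => by rw [Nat.cast_succ, ← add_assoc, Real.Gamma_add_one (by positivity)]
      have hr := tsum_gaussTerm_rel ha hb (show a + b < c + N by
        have : (0 : ℝ) ≤ N := by positivity
        linarith)
      have g3 := (hp h3 N).ne'
      have g3' : c - a - b + N ≠ 0 := by positivity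
      simp only [hG]
      rw [e h1, e h2, e h3, Nat.cast_succ, ← add_assoc, div_eq_div_iff (by positivity) g3]
      linear_combination (-(Real.Gamma (c - a + N) * Real.Gamma (c - b + N) *
        Real.Gamma (c - a - b + N))) * hr
  have hlim := (tendsto_gamma_ratio h1 h2 h4 h3 (by ring)).mul
    (tendsto_gamma_mul_tsum_gaussTerm ha hb h)
  have hlim' : Tendsto G atTop (𝓝 (1 * (Real.Gamma a * Real.Gamma b))) := by
    refine hlim.congr fun N => ?_
    have g3 := (hp h3 N).ne'
    have g4 := (hp h4 N).ne'
    simp only [hG]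
    field_simp
  have hval := tendsto_nhds_unique hlim' (tendsto_const_nhds.congr fun N => (hconst N).symm)
  have g1 := (Real.Gamma_pos_of_pos h1).ne'
  have g2 := (Real.Gamma_pos_of_pos h2).ne'
  have g3 := (Real.Gamma_pos_of_pos h3).ne'
  simp only [hG, Nat.cast_zero, add_zero, one_mul] at hval
  rw [hval]
  field_simp

theorem hasSum_gaussTerm {a b c : ℝ} (ha : 0 < a) (hb : 0 < b) (h : a + b < c) :
    HasSum (gaussTerm a b c) (Real.Gamma a * Real.Gamma b * Real.Gamma (c - a - b) /
      (Real.Gamma (c - a) * Real.Gamma (c - b))) :=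
  tsum_gaussTerm ha hb h ▸ (summable_gaussTerm ha hb h).hasSum

/-! ### Thomae's transformation for positive parameters -/

/-- Gauss's theorem read backwards: with parameters `d - a, e - a; d + e - a + n` the Gauss excess
is `a + n`, which yields the factor `Γ(a+n) / (Γ(d+n) Γ(e+n))`. -/
theorem hasSum_gamma_mul_hypTerm_left {b c a d e : ℝ} (ha : 0 < a) (hd : 0 < d - a) (he : 0 < e - a)
    (n : ℕ) :
    HasSum (fun m : ℕ => Real.Gamma (b + n) * Real.Gamma (c + n) / n.factorial *
        gaussTerm (d - a) (e - a) (d + e - a + n) m)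
      (Real.Gamma (d - a) * Real.Gamma (e - a) * hypTerm ![a, b, c, d, e] n) := by
  have hn : (0 : ℝ) ≤ n := by positivity
  convert (hasSum_gaussTerm hd he (show d - a + (e - a) < d + e - a + n by linarith)).mul_left
    (Real.Gamma (b + n) * Real.Gamma (c + n) / n.factorial) using 1
  · rfl
  rw [show d + e - a + n - (d - a) - (e - a) = a + n by ring,
    show d + e - a + n - (d - a) = e + n by ring, show d + e - a + n - (e - a) = d + n by ring]
  simp only [hypTerm, Matrix.cons_val, div_eq_mul_inv, mul_inv]
  ring

theorem hasSum_gamma_mul_hypTerm_right {b c a d e : ℝ} (hb : 0 < b) (hc : 0 < c)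
    (hs : 0 < d + e - a - b - c) (m : ℕ) :
    HasSum (fun n : ℕ => Real.Gamma (d - a + m) * Real.Gamma (e - a + m) / m.factorial *
        gaussTerm b c (d + e - a + m) n)
      (Real.Gamma b * Real.Gamma c * hypTerm ![d - a, e - a, d + e - a - b - c,
        d + e - a - c, d + e - a - b] m) := by
  have hm : (0 : ℝ) ≤ m := by positivity
  convert (hasSum_gaussTerm hb hc (show b + c < d + e - a + m by linarith)).mul_left
    (Real.Gamma (d - a + m) * Real.Gamma (e - a + m) / m.factorial) using 1
  · rfl
  rw [show d + e - a + m - b - c = d + e - a - b - c + m by ring,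
    show d + e - a + m - b = d + e - a - b + m by ring,
    show d + e - a + m - c = d + e - a - c + m by ring]
  simp only [hypTerm, Matrix.cons_val, div_eq_mul_inv, mul_inv]
  ring

/-- Both sides are iterated sums of one double series, taken in the two orders, with the inner sum
evaluated by Gauss's theorem each time. -/
theorem tsum_hypTerm_thomae {a b c d e : ℝ} (ha : 0 < a) (hb : 0 < b) (hc : 0 < c)
    (hd : 0 < d - a) (he : 0 < e - a) (hs : 0 < d + e - a - b - c) :
    Real.Gamma (d - a) * Real.Gamma (e - a) * ∑' n, hypTerm ![a, b, c, d, e] n =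
      Real.Gamma b * Real.Gamma c * ∑' m, hypTerm ![d - a, e - a, d + e - a - b - c,
        d + e - a - c, d + e - a - b] m := by
  set f : ℕ × ℕ → ℝ := fun i => Real.Gamma (b + i.1) * Real.Gamma (c + i.1) / i.1.factorial *
    gaussTerm (d - a) (e - a) (d + e - a + i.1) i.2 with hf
  -- The two indices are coupled only through `Γ(d + e - a + n + m)`, so either one can play the
  -- role of the Gauss index.
  have hsymm : ∀ n m : ℕ, f (n, m) = Real.Gamma (d - a + m) * Real.Gamma (e - a + m) /
      m.factorial * gaussTerm b c (d + e - a + m) n := by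
    intro n m
    simp only [hf, gaussTerm]
    rw [add_right_comm (d + e - a)]
    simp only [div_eq_mul_inv, mul_inv]
    ring
  have hl := fun n => hasSum_gamma_mul_hypTerm_left (b := b) (c := c) ha hd he n
  have hr := fun m => hasSum_gamma_mul_hypTerm_right (a := a) (d := d) (e := e) hb hc hs m
  simp only [← hsymm] at hr
  have hnonneg : 0 ≤ f := fun i => by
    have h1 := Real.Gamma_pos_of_pos (show 0 < b + i.1 by positivity)
    have h2 := Real.Gamma_pos_of_pos (show 0 < c + i.1 by positivity)
    have h3 : 0 < d + e - a + i.1 := by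
      have : (0 : ℝ) ≤ i.1 := by positivity
      linarith
    have := gaussTerm_nonneg hd he h3 i.2
    simp only [hf, Pi.zero_apply]
    positivity
  -- For nonnegative terms, summability over pairs follows from that of the iterated sums, here a
  -- multiple of the convergent original series.
  have hsum : Summable f := by
    rw [summable_prod_of_nonneg hnonneg]
    refine ⟨fun n => (hl n).summable, ?_⟩
    have : (fun n => ∑' m, f (n, m)) = fun n =>
      Real.Gamma (d - a) * Real.Gamma (e - a) * hypTerm ![a, b, c, d, e] n :=
      funext fun n => (hl n).tsum_eq
    rw [this]
    exact (summable_hypTerm ha hb hc hs).mul_left _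
  have hcomm := Summable.tsum_comm (f := fun n m => f (n, m)) hsum
  rw [tsum_congr fun n => (hl n).tsum_eq, tsum_congr fun m => (hr m).tsum_eq, tsum_mul_left,
    tsum_mul_left] at hcomm
  exact hcomm.symm

theorem baseE_ofReal {r : Fin 5 → ℝ} (h0 : 0 < r 0) (h1 : 0 < r 1) (h2 : 0 < r 2) :
    baseE (fun i => (r i : ℂ)) = (((Real.Gamma (r 3 + r 4 - r 0 - r 1 - r 2))⁻¹ *
      ((∑' n, hypTerm r n) / (Real.Gamma (r 0) * Real.Gamma (r 1) * Real.Gamma (r 2))) : ℝ) : ℂ) := by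
  have e : (excess fun i => (r i : ℂ)) = ((r 3 + r 4 - r 0 - r 1 - r 2 : ℝ) : ℂ) := by
    simp [excess]
  unfold baseE
  rw [e, Complex.Gamma_ofReal, tsum_congr fun n => normTerm_ofReal h0 h1 h2 n,
    ← Complex.ofReal_tsum, tsum_div_const]
  push_cast
  rfl

/-- The new parameters have excess `a`, and `s` is now an upper parameter. The normalising gamma
factors therefore absorb the prefactors of Thomae's formula, which becomes a plain invariance. -/
theorem baseE_thomae {a b c d e : ℝ} (ha : 0 < a) (hb : 0 < b) (hc : 0 < c)
    (hd : 0 < d - a) (he : 0 < e - a) (hs : 0 < d + e - a - b - c) :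
    baseE (fun i => ((![a, b, c, d, e] i : ℝ) : ℂ)) =
      baseE (fun i => ((![d - a, e - a, d + e - a - b - c,
        d + e - a - c, d + e - a - b] i : ℝ) : ℂ)) := by
  have key := tsum_hypTerm_thomae ha hb hc hd he hs
  rw [baseE_ofReal ha hb hc, baseE_ofReal hd he hs]
  congr 1
  simp only [Matrix.cons_val]
  rw [show d + e - a - c + (d + e - a - b) - (d - a) - (e - a) - (d + e - a - b - c) = a by ring]
  have g1 := (Real.Gamma_pos_of_pos ha).ne'
  have g2 := (Real.Gamma_pos_of_pos hb).ne'
  have g3 := (Real.Gamma_pos_of_pos hc).ne'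
  have g4 := (Real.Gamma_pos_of_pos hd).ne'
  have g5 := (Real.Gamma_pos_of_pos he).ne'
  have g6 := (Real.Gamma_pos_of_pos hs).ne'
  field_simp
  linear_combination key

/-! ### An identity theorem -/

/-- An entire function that vanishes when all variables are real and positive is zero. -/
theorem eq_zero_of_eq_zero_on_positive {ι : Type*} [Fintype ι] [DecidableEq ι] {F : (ι → ℂ) → ℂ}
    (hF : Differentiable ℂ F) (h : ∀ r : ι → ℝ, (∀ i, 0 < r i) → F (fun i => (r i : ℂ)) = 0)
    (q : ι → ℂ) : F q = 0 := by
  -- Coordinates in `s` are arbitrary complex, the others positive reals. The induction frees one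
  -- variable at a time by the one-variable identity theorem.
  suffices ∀ s : Finset ι, ∀ q : ι → ℂ, (∀ i ∉ s, ∃ t : ℝ, 0 < t ∧ q i = t) → F q = 0 from
    this Finset.univ q (by simp)
  intro s
  induction s using Finset.induction_on with
  | empty =>
    intro q hq
    choose r hr hqr using fun i => hq i (Finset.notMem_empty i)
    rw [funext hqr]
    exact h r hr
  | insert j s hj ih =>
    intro q hq
    have hd : Differentiable ℂ fun z : ℂ => F (Function.update q j z) := by
      refine hF.comp (differentiable_pi.2 fun i => ?_)
      by_cases hij : i = j
      · subst hij
        simp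
      · simp [Function.update_of_ne hij]
    have hz : ∀ t : ℝ, 0 < t → F (Function.update q j t) = 0 := by
      intro t ht
      refine ih _ fun i hi => ?_
      by_cases hij : i = j
      · subst hij
        exact ⟨t, ht, by simp⟩
      · rw [Function.update_of_ne hij]
        exact hq i (by simp [hij, hi])
    -- The zeros at real `t > 1` accumulate at `1`.
    have hfreq : ∃ᶠ z : ℂ in 𝓝[≠] ((1 : ℝ) : ℂ), F (Function.update q j z) = 0 := by
      have hmap : Tendsto (fun t : ℝ => (t : ℂ)) (𝓝[>] 1) (𝓝[≠] ((1 : ℝ) : ℂ)) := by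
        refine tendsto_nhdsWithin_iff.2 ⟨(Complex.continuous_ofReal.tendsto 1).mono_left
          nhdsWithin_le_nhds, ?_⟩
        filter_upwards [self_mem_nhdsWithin] with t ht
        simpa using (ne_of_gt ht : t ≠ 1)
      refine hmap.frequently (Eventually.frequently ?_)
      filter_upwards [self_mem_nhdsWithin] with t ht
      exact hz t (lt_trans one_pos ht)
    have han : AnalyticOnNhd ℂ (fun z : ℂ => F (Function.update q j z)) Set.univ :=
      fun z _ => hd.analyticAt z
    have := AnalyticOnNhd.eq_of_frequently_eq han (analyticOnNhd_const (v := (0 : ℂ))) hfreq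
    simpa using congrFun this (q j)

/-! ### Invariance of the continuation -/

theorem vecMul_matA (q : Fin 5 → ℂ) : Matrix.vecMul q matA =
    ![q 0 + q 3 + q 4, q 1 + q 3 + q 4, q 2 + q 3 + q 4, q 0 + q 1 + q 2 + 2 * q 3 + q 4,
      q 0 + q 1 + q 2 + q 3 + 2 * q 4] := by
  ext i
  fin_cases i <;> simp [Matrix.vecMul, dotProduct, Fin.sum_univ_five, matA] <;> ring

/-- The parameters `(a, b, c; d, e)` with given real coordinates `x, y, z, u, v`. -/
def realParam (r : Fin 5 → ℝ) : Fin 5 → ℝ :=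
  ![r 0 + r 3 + r 4, r 1 + r 3 + r 4, r 2 + r 3 + r 4, r 0 + r 1 + r 2 + 2 * r 3 + r 4,
    r 0 + r 1 + r 2 + r 3 + 2 * r 4]

theorem vecMul_matA_ofReal (r : Fin 5 → ℝ) :
    Matrix.vecMul (fun i => (r i : ℂ)) matA = fun i => (realParam r i : ℂ) := by
  rw [vecMul_matA]
  ext i
  fin_cases i <;> simp [realParam]

theorem converges_ofReal {r : Fin 5 → ℝ} (hs : 0 < r 3 + r 4 - r 0 - r 1 - r 2) (h3 : 0 < r 3)
    (h4 : 0 < r 4) : Converges fun i => (r i : ℂ) := by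
  have key : ∀ x : ℝ, 0 < x → ∀ k : ℕ, (x : ℂ) ≠ -(k : ℂ) := by
    intro x hx k h
    have h1 := congrArg Complex.re h
    simp only [Complex.ofReal_re, Complex.neg_re, Complex.natCast_re] at h1
    have : (0 : ℝ) ≤ k := by positivity
    linarith
  exact ⟨by rwa [excess_ofReal], key _ h3, key _ h4⟩

theorem continuedE_of_converges {p : Fin 5 → ℂ} (hp : Converges p) : continuedE p = baseE p := by
  rw [continuedE_spec.2 p hp, baseE_of_converges p hp]

/-- Positive coordinates lie in the domain of convergence: `d` and `e` are positive sums, and `s = x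
+ y + z`. -/
theorem continuedE_realParam {r : Fin 5 → ℝ} (hr : ∀ i, 0 < r i) :
    continuedE (fun i => (realParam r i : ℂ)) = baseE (fun i => (realParam r i : ℂ)) := by
  have h0 := hr 0
  have h1 := hr 1
  have h2 := hr 2
  have h3 := hr 3
  have h4 := hr 4
  refine continuedE_of_converges (converges_ofReal ?_ ?_ ?_) <;>
    simp only [realParam, Matrix.cons_val] <;> linarith

/-- Both sides are entire in `q`, so agreement on the positive orthant suffices. -/
theorem continuedE_comp_eq {σ : Equiv.Perm (Fin 5)}
    (h : ∀ r : Fin 5 → ℝ, (∀ i, 0 < r i) → baseE (fun i => (realParam (r ∘ σ) i : ℂ)) =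
      baseE (fun i => (realParam r i : ℂ))) (q : Fin 5 → ℂ) :
    continuedE (Matrix.vecMul (q ∘ σ) matA) = continuedE (Matrix.vecMul q matA) := by
  have hE := continuedE_spec.1
  have hl : ∀ σ : Equiv.Perm (Fin 5),
      Differentiable ℂ fun q : Fin 5 → ℂ => Matrix.vecMul (q ∘ σ) matA := by
    intro σ
    simp only [vecMul_matA]
    refine differentiable_pi.2 fun i => ?_
    fin_cases i <;> simp <;> fun_prop
  refine sub_eq_zero.1 (eq_zero_of_eq_zero_on_positive
    (F := fun q => continuedE (Matrix.vecMul (q ∘ σ) matA) - continuedE (Matrix.vecMul q matA))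
    ((hE.comp (hl σ)).sub (hE.comp (hl 1))) ?_ q)
  intro r hr
  have e : (fun i => (r i : ℂ)) ∘ σ = fun i => ((r ∘ σ) i : ℂ) := rfl
  simp only [e, vecMul_matA_ofReal]
  rw [continuedE_realParam hr, continuedE_realParam (r := r ∘ σ) (fun i => hr _), h r hr, sub_self]

theorem baseE_swap {r : Fin 5 → ℝ} :
    baseE (fun i => (realParam (r ∘ Equiv.swap 0 1) i : ℂ)) =
      baseE (fun i => (realParam r i : ℂ)) := by
  have e : realParam (r ∘ Equiv.swap 0 1) =
      ![realParam r 1, realParam r 0, realParam r 2, realParam r 3, realParam r 4] := by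
    ext i
    fin_cases i <;>
      simp [realParam, Equiv.swap_apply_def] <;> ring
  have ht : ∀ n, normTerm n (fun i => (realParam (r ∘ Equiv.swap 0 1) i : ℂ)) =
      normTerm n (fun i => (realParam r i : ℂ)) := by
    intro n
    rw [e]
    simp only [normTerm, Matrix.cons_val]
    ring
  have hx : excess (fun i => (realParam (r ∘ Equiv.swap 0 1) i : ℂ)) =
      excess (fun i => (realParam r i : ℂ)) := by
    rw [e]
    simp only [excess, Matrix.cons_val]
    ring
  unfold baseE
  rw [hx, tsum_congr ht]

/-- In these coordinates Thomae's transformation is the cyclic shift `(x, y, z, u, v) ↦ (u, v, x, y,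
z)`, since `d - a = y + z + u`, `e - a = y + z + v` and `s = x + y + z`. -/
theorem baseE_addRight {r : Fin 5 → ℝ} (hr : ∀ i, 0 < r i) :
    baseE (fun i => (realParam (r ∘ Equiv.addRight (3 : Fin 5)) i : ℂ)) =
      baseE (fun i => (realParam r i : ℂ)) := by
  have h0 := hr 0
  have h1 := hr 1
  have h2 := hr 2
  have h3 := hr 3
  have h4 := hr 4
  have key := baseE_thomae (a := r 0 + r 3 + r 4) (b := r 1 + r 3 + r 4) (c := r 2 + r 3 + r 4)
    (d := r 0 + r 1 + r 2 + 2 * r 3 + r 4) (e := r 0 + r 1 + r 2 + r 3 + 2 * r 4)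
    (by linarith) (by linarith) (by linarith) (by linarith) (by linarith) (by linarith)
  unfold realParam
  rw [key]
  congr 1
  ext i
  congr 1
  have e : ∀ i j : Fin 5, i + 3 = j → (r ∘ Equiv.addRight (3 : Fin 5)) i = r j := by
    rintro i _ rfl
    rfl
  rw [e 0 3 rfl, e 1 4 rfl, e 2 0 rfl, e 3 1 rfl, e 4 2 rfl]
  fin_cases i <;> simp <;> ring

/-- The continuation is a symmetric function of the coordinates `x, y, z, u, v`. -/
theorem continuedE_symmetric (σ : Equiv.Perm (Fin 5)) (q : Fin 5 → ℂ) :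
    continuedE (Matrix.vecMul (q ∘ σ) matA) = continuedE (Matrix.vecMul q matA) := by
  have htop : Subgroup.closure ({Equiv.addRight (3 : Fin 5), Equiv.swap 0 1} :
      Set (Equiv.Perm (Fin 5))) = ⊤ := by
    refine Equiv.Perm.closure_prime_cycle_swap (by simpa using Nat.prime_five) ?_ (by decide)
      ⟨0, 1, by decide, rfl⟩
    refine ⟨0, by decide, fun y _ => ?_⟩
    -- The exponents `k` solve `3 k ≡ y` modulo `5`.
    fin_cases y
    · exact ⟨0, by decide⟩
    · exact ⟨2, by decide⟩
    · exact ⟨4, by decide⟩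
    · exact ⟨1, by decide⟩
    · exact ⟨3, by decide⟩
  have hσ : σ ∈ Subgroup.closure ({Equiv.addRight (3 : Fin 5), Equiv.swap 0 1} :
      Set (Equiv.Perm (Fin 5))) := htop ▸ Subgroup.mem_top σ
  induction hσ using Subgroup.closure_induction generalizing q with
  | mem τ hτ =>
    rcases hτ with rfl | rfl
    · exact continuedE_comp_eq (fun r hr => baseE_addRight hr) q
    · exact continuedE_comp_eq (fun r _ => baseE_swap) q
  | one => rfl
  | mul τ ρ _ _ h1 h2 =>
    rw [Equiv.Perm.coe_mul, ← Function.comp_assoc, h2, h1]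
  | inv τ _ h =>
    rw [← h (q ∘ ⇑τ⁻¹), Function.comp_assoc, ← Equiv.Perm.coe_mul, inv_mul_cancel]
    rfl

/-! ### The elements of the Thomae group -/

/-- The matrix `A` over `ℚ`. -/
def ratA : Matrix (Fin 5) (Fin 5) ℚ :=
  !![1, 0, 0, 1, 1;
     0, 1, 0, 1, 1;
     0, 0, 1, 1, 1;
     1, 1, 1, 2, 1;
     1, 1, 1, 1, 2]

/-- The inverse of `A`. -/
def ratB : Matrix (Fin 5) (Fin 5) ℚ :=
  (1 / 3 : ℚ) • !![1, -2, -2, 1, 1;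
                   -2, 1, -2, 1, 1;
                   -2, -2, 1, 1, 1;
                   1, 1, 1, 1, -2;
                   1, 1, 1, -2, 1]

/-- The inverse of `A` over `ℂ`. -/
def matB : Matrix (Fin 5) (Fin 5) ℂ := ratB.map (algebraMap ℚ ℂ)

/-- Over `ℚ` the inverse can be verified by decidable arithmetic, and rationality of the group
elements becomes visible. -/
theorem matA_eq : matA = ratA.map (algebraMap ℚ ℂ) := by
  ext i j
  fin_cases i <;> fin_cases j <;> simp [matA, ratA]

theorem ratA_mul_ratB : ratA * ratB = 1 := by decide +kernel

theorem matA_mul_matB : matA * matB = 1 := by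
  rw [matA_eq, matB, ← Matrix.map_mul, ratA_mul_ratB, Matrix.map_one _ (map_zero _) (map_one _)]

theorem matB_mul_matA : matB * matA = 1 := mul_eq_one_comm.1 matA_mul_matB

theorem vecMul_matA_matB (q : Fin 5 → ℂ) : Matrix.vecMul (Matrix.vecMul q matA) matB = q := by
  rw [Matrix.vecMul_vecMul, matA_mul_matB, Matrix.vecMul_one]

theorem vecMul_matB_matA (p : Fin 5 → ℂ) : Matrix.vecMul (Matrix.vecMul p matB) matA = p := by
  rw [Matrix.vecMul_vecMul, matB_mul_matA, Matrix.vecMul_one]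

/-- The rational matrix that permutes the coordinates `x, y, z, u, v` by `σ`. -/
def ratPerm (σ : Equiv.Perm (Fin 5)) : Matrix (Fin 5) (Fin 5) ℚ := ratB.submatrix id σ * ratA

/-- The columns of `A⁻¹` produce the coordinates `x, y, z, u, v`; permuting these columns permutes
the coordinates, and `A` leads back to `(a, b, c; d, e)`. -/
theorem vecMul_ratPerm (σ : Equiv.Perm (Fin 5)) (p : Fin 5 → ℂ) :
    Matrix.vecMul p ((ratPerm σ).map (algebraMap ℚ ℂ)) =
      Matrix.vecMul (Matrix.vecMul p matB ∘ σ) matA := by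
  rw [ratPerm, Matrix.map_mul, ← matA_eq, ← Matrix.vecMul_vecMul]
  rfl

theorem ext_vecMul {M N : Matrix (Fin 5) (Fin 5) ℂ}
    (h : ∀ p : Fin 5 → ℂ, Matrix.vecMul p M = Matrix.vecMul p N) : M = N := by
  ext i j
  simpa using congrFun (h (Pi.single i 1)) j

theorem ratPerm_mul (σ τ : Equiv.Perm (Fin 5)) :
    (ratPerm σ).map (algebraMap ℚ ℂ) * (ratPerm τ).map (algebraMap ℚ ℂ) =
      (ratPerm (σ * τ)).map (algebraMap ℚ ℂ) :=
  ext_vecMul fun p => by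
    rw [← Matrix.vecMul_vecMul, vecMul_ratPerm, vecMul_ratPerm, vecMul_ratPerm, vecMul_matA_matB]
    rfl

theorem ratPerm_one : (ratPerm 1).map (algebraMap ℚ ℂ) = 1 :=
  ext_vecMul fun p => by
    rw [vecMul_ratPerm, Equiv.Perm.coe_one, Function.comp_id, vecMul_matB_matA, Matrix.vecMul_one]

/-- The element of `GL(5, ℂ)` that permutes the coordinates `x, y, z, u, v` by `σ`. -/
def permGL (σ : Equiv.Perm (Fin 5)) : GL (Fin 5) ℂ where
  val := (ratPerm σ).map (algebraMap ℚ ℂ)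
  inv := (ratPerm σ⁻¹).map (algebraMap ℚ ℂ)
  val_inv := by rw [ratPerm_mul, mul_inv_cancel, ratPerm_one]
  inv_val := by rw [ratPerm_mul, inv_mul_cancel, ratPerm_one]

theorem vecMul_permGL (σ : Equiv.Perm (Fin 5)) (p : Fin 5 → ℂ) :
    Matrix.vecMul p (permGL σ : Matrix (Fin 5) (Fin 5) ℂ) =
      Matrix.vecMul (Matrix.vecMul p matB ∘ σ) matA := vecMul_ratPerm σ p

theorem mem_thomaeGroup_iff {T : GL (Fin 5) ℂ} : T ∈ thomaeGroup ↔ ∃ σ, permGL σ = T := by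
  constructor
  · rintro ⟨σ, hσ⟩
    refine ⟨σ, Units.ext (ext_vecMul fun p => ?_)⟩
    rw [vecMul_permGL, ← hσ, vecMul_matB_matA]
  · rintro ⟨σ, rfl⟩
    exact ⟨σ, fun q => by rw [vecMul_permGL, vecMul_matA_matB]⟩

theorem permGL_injective : Function.Injective permGL := by
  intro σ τ h
  -- The test vector has distinct coordinates `0, 1, 2, 3, 4`, so the permutation can be read off
  -- from its image.
  have h1 := congrArg (fun T : GL (Fin 5) ℂ => Matrix.vecMul (Matrix.vecMul
    (Matrix.vecMul (fun i : Fin 5 => ((i : ℕ) : ℂ)) matA) (T : Matrix (Fin 5) (Fin 5) ℂ)) matB) h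
  simp only [vecMul_permGL, vecMul_matA_matB] at h1
  ext i
  have := congrFun h1 i
  simp only [Function.comp_apply, Nat.cast_inj] at this
  exact this

theorem card_thomaeGroup : Nat.card thomaeGroup = 120 := by
  have hb : Function.Bijective fun σ : Equiv.Perm (Fin 5) =>
      (⟨permGL σ, mem_thomaeGroup_iff.2 ⟨σ, rfl⟩⟩ : thomaeGroup) := by
    refine ⟨fun σ τ h => permGL_injective (congrArg Subtype.val h), fun T => ?_⟩
    obtain ⟨σ, hσ⟩ := mem_thomaeGroup_iff.1 T.2
    exact ⟨σ, Subtype.ext hσ⟩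
  rw [← Nat.card_eq_of_bijective _ hb, Nat.card_perm, Nat.card_fin]
  rfl

theorem continuedE_vecMul {T : GL (Fin 5) ℂ} (hT : T ∈ thomaeGroup) (p : Fin 5 → ℂ) :
    continuedE (Matrix.vecMul p (T : Matrix (Fin 5) (Fin 5) ℂ)) = continuedE p := by
  obtain ⟨σ, rfl⟩ := mem_thomaeGroup_iff.1 hT
  rw [vecMul_permGL, continuedE_symmetric, vecMul_matB_matA]

/-! ### Transformed sets -/

theorem vecMul_inv_vecMul (T : GL (Fin 5) ℂ) (p : Fin 5 → ℂ) :
    Matrix.vecMul (Matrix.vecMul p (T : Matrix (Fin 5) (Fin 5) ℂ))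
      ((T⁻¹ : GL (Fin 5) ℂ) : Matrix (Fin 5) (Fin 5) ℂ) = p := by
  rw [Matrix.vecMul_vecMul, ← Units.val_mul, mul_inv_cancel, Units.val_one, Matrix.vecMul_one]

theorem vecMul_vecMul_inv (T : GL (Fin 5) ℂ) (p : Fin 5 → ℂ) :
    Matrix.vecMul (Matrix.vecMul p ((T⁻¹ : GL (Fin 5) ℂ) : Matrix (Fin 5) (Fin 5) ℂ))
      (T : Matrix (Fin 5) (Fin 5) ℂ) = p := by
  rw [Matrix.vecMul_vecMul, ← Units.val_mul, inv_mul_cancel, Units.val_one, Matrix.vecMul_one]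

theorem mem_transform {T : GL (Fin 5) ℂ} {V : Set (Fin 5 → ℂ)} {p : Fin 5 → ℂ} :
    p ∈ transform T V ↔
      Matrix.vecMul p ((T⁻¹ : GL (Fin 5) ℂ) : Matrix (Fin 5) (Fin 5) ℂ) ∈ V := by
  constructor
  · rintro ⟨v, hv, rfl⟩
    rwa [vecMul_inv_vecMul]
  · exact fun h => ⟨_, h, vecMul_vecMul_inv T p⟩

theorem transform_inv_transform (T : GL (Fin 5) ℂ) (V : Set (Fin 5 → ℂ)) :
    transform T⁻¹ (transform T V) = V := by
  ext p
  rw [mem_transform, mem_transform, inv_inv, vecMul_inv_vecMul]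

/-- The equations of `V` are pulled back along the linear substitution `p ↦ p T⁻¹`. -/
theorem IsVariety.transform {V : Set (Fin 5 → ℂ)} (hV : IsVariety V) (T : GL (Fin 5) ℂ) :
    IsVariety (transform T V) := by
  obtain ⟨S, rfl⟩ := hV
  set g : Fin 5 → MvPolynomial (Fin 5) ℂ := fun j => ∑ i, MvPolynomial.X i *
    MvPolynomial.C (((T⁻¹ : GL (Fin 5) ℂ) : Matrix (Fin 5) (Fin 5) ℂ) i j) with hg
  refine ⟨MvPolynomial.bind₁ g '' S, ?_⟩
  ext p
  have key : ∀ f, MvPolynomial.eval p (MvPolynomial.bind₁ g f) = MvPolynomial.eval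
      (Matrix.vecMul p ((T⁻¹ : GL (Fin 5) ℂ) : Matrix (Fin 5) (Fin 5) ℂ)) f := by
    intro f
    rw [← MvPolynomial.coe_aeval_eq_eval, ← MvPolynomial.coe_aeval_eq_eval]
    simp only [RingHom.coe_coe, MvPolynomial.aeval_bind₁]
    congr 2
    funext j
    simp [hg, Matrix.vecMul, dotProduct]
  rw [mem_transform]
  simp only [Set.mem_ofPred_eq, Set.forall_mem_image, key]

/-- The affine function `p ↦ l (p M)`. -/
def RatAffine.comp (M : Matrix (Fin 5) (Fin 5) ℚ) (l : RatAffine) : RatAffine :=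
  (M.mulVec l.1, l.2)

/-- Moving `M` across the dot product turns a substitution in the point into a rational change of
coefficients. -/
theorem RatAffine.value_comp (M : Matrix (Fin 5) (Fin 5) ℚ) (l : RatAffine) (p : Fin 5 → ℂ) :
    (l.comp M).value p = l.value (Matrix.vecMul p (M.map (algebraMap ℚ ℂ))) := by
  have h : ∀ (v : Fin 5 → ℚ) (q : Fin 5 → ℂ), ∑ i, (v i : ℂ) * q i =
      dotProduct q (algebraMap ℚ ℂ ∘ v) := fun v q =>
    Finset.sum_congr rfl fun i _ => mul_comm _ _
  unfold RatAffine.value RatAffine.comp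
  rw [h, h, ← Matrix.dotProduct_mulVec]
  congr 2
  exact funext fun i => RingHom.map_mulVec (algebraMap ℚ ℂ) M l.1 i

theorem gammaQuotient_comp (M : Matrix (Fin 5) (Fin 5) ℚ) (N D : List RatAffine) (p : Fin 5 → ℂ) :
    gammaQuotient (N.map (RatAffine.comp M)) (D.map (RatAffine.comp M)) p =
      gammaQuotient N D (Matrix.vecMul p (M.map (algebraMap ℚ ℂ))) := by
  simp only [gammaQuotient, List.map_map, Function.comp_def, RatAffine.value_comp]

theorem noPole_comp (M : Matrix (Fin 5) (Fin 5) ℚ) (N : List RatAffine) (p : Fin 5 → ℂ) :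
    NoPole (N.map (RatAffine.comp M)) p ↔
      NoPole N (Matrix.vecMul p (M.map (algebraMap ℚ ℂ))) := by
  simp only [NoPole, List.forall_mem_map, RatAffine.value_comp]

/-- In the domain of convergence `Γ(d)`, `Γ(e)` and `Γ(s)` are nonzero, so the normalising
denominator can be cleared. -/
theorem hyp3F2_eq_of_continuedE_eq {N D : List RatAffine} {p : Fin 5 → ℂ} (hp : Converges p)
    (h : continuedE p = gammaQuotient N D p) :
    hyp3F2 p = gammaQuotient (formD :: formE :: formS :: N) D p := by
  have hs : ∀ k : ℕ, excess p ≠ -(k : ℂ) := by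
    intro k hk
    have h1 := hp.1
    rw [hk] at h1
    simp only [Complex.neg_re, Complex.natCast_re] at h1
    have : (0 : ℝ) ≤ k := by positivity
    linarith
  have g1 := Complex.Gamma_ne_zero hp.2.1
  have g2 := Complex.Gamma_ne_zero hp.2.2
  have g3 := Complex.Gamma_ne_zero hs
  have e1 : formD.value p = p 3 := by simp [RatAffine.value, formD, Fin.sum_univ_five]
  have e2 : formE.value p = p 4 := by simp [RatAffine.value, formE, Fin.sum_univ_five]
  have e3 : formS.value p = excess p := by
    simp [RatAffine.value, formS, Fin.sum_univ_five, excess]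
    ring
  rw [continuedE_spec.2 p hp, div_eq_iff (by positivity)] at h
  rw [h]
  simp only [gammaQuotient, List.map_cons, List.prod_cons, e1, e2, e3]
  ring

theorem GammaQuotientSummation.transform {V : Set (Fin 5 → ℂ)} (hV : GammaQuotientSummation V)
    {T : GL (Fin 5) ℂ} (hT : T ∈ thomaeGroup) : GammaQuotientSummation (transform T V) := by
  obtain ⟨σ, hσ⟩ := mem_thomaeGroup_iff.1 (inv_mem hT)
  have hM : (ratPerm σ).map (algebraMap ℚ ℂ) =
      ((T⁻¹ : GL (Fin 5) ℂ) : Matrix (Fin 5) (Fin 5) ℂ) := by rw [← hσ]; rfl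
  -- The identity for convergent series is discarded: `T` need not preserve convergence, so that
  -- clause is recovered on `T V` from the continued identity.
  obtain ⟨N, D, hgen, -, hformal⟩ := hV
  have hformal' : ∀ p ∈ Thomae.transform T V, NoPole (N.map (RatAffine.comp (ratPerm σ))) p →
      continuedE p = gammaQuotient (N.map (RatAffine.comp (ratPerm σ)))
        (D.map (RatAffine.comp (ratPerm σ))) p := by
    intro p hp hN
    rw [noPole_comp, hM] at hN
    rw [gammaQuotient_comp, hM, ← hformal _ (mem_transform.1 hp) hN, continuedE_vecMul (inv_mem hT)]
  refine ⟨N.map (RatAffine.comp (ratPerm σ)), D.map (RatAffine.comp (ratPerm σ)), ?_,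
    fun p hp hc hN => hyp3F2_eq_of_continuedE_eq hc (hformal' p hp hN), hformal'⟩
  have hcont : Continuous fun p : Fin 5 → ℂ =>
      Matrix.vecMul p (T : Matrix (Fin 5) (Fin 5) ℂ) := by fun_prop
  rintro _ ⟨v, hv, rfl⟩
  -- Continuity of `p ↦ p T` carries the closure of the pole-free points of `V` into the closure of
  -- their images.
  refine closure_mono ?_ (image_closure_subset_closure_image hcont ⟨v, hgen hv, rfl⟩)
  rintro _ ⟨w, ⟨hw, hN⟩, rfl⟩
  refine ⟨⟨w, hw, rfl⟩, ?_⟩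
  rw [noPole_comp, hM, vecMul_inv_vecMul]
  exact hN

theorem gammaQuotientSummation_transform_iff {V : Set (Fin 5 → ℂ)} {T : GL (Fin 5) ℂ}
    (hT : T ∈ thomaeGroup) :
    GammaQuotientSummation (transform T V) ↔ GammaQuotientSummation V := by
  refine ⟨fun h => ?_, fun h => h.transform hT⟩
  have := h.transform (inv_mem hT)
  rwa [transform_inv_transform] at this

end

end Thomae

theorem mainTheorem12 :
    Nat.card Thomae.thomaeGroup = 120 ∧
    ∀ V : Set (Fin 5 → ℂ), Thomae.IsVariety V →
      (Thomae.GammaQuotientSummation V →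
        ∀ T ∈ Thomae.thomaeGroup,
          Thomae.IsVariety (Thomae.transform T V) ∧
          Thomae.GammaQuotientSummation (Thomae.transform T V)) ∧
      (∀ T ∈ Thomae.thomaeGroup,
        (Thomae.GammaQuotientSummation (Thomae.transform T V) ↔
          Thomae.GammaQuotientSummation V)) :=
  ⟨Thomae.card_thomaeGroup, fun _ hV =>
    ⟨fun h T hT => ⟨hV.transform T, h.transform hT⟩,
      fun _ hT => Thomae.gammaQuotientSummation_transform_iff hT⟩⟩
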